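/- **Setting.** Let $\omega(x)=\frac12+\frac14\sqrt{1+x^2}$ and let $0\le C_1<\dots<C_\ell\le 1$ be the concurrences of $\ell$ authorization levels. The concurrence of a two-qubit state $\rho$ is $\max\{0,\sqrt{\lambda_1}-\sqrt{\lambda_2}-\sqrt{\lambda_3}-\sqrt{\lambda_4}\}$, where $\lambda_1\ge\dots\ge\lambda_4$ are the eigenvalues of $\rho(\sigma^y\otimes\sigma^y)\rho^*(\sigma^y\otimes\sigma^y)$. Each User $u$ of a finite set of Users has a level $k_u$ and shares with the Authorizer $N$ independent pairs $\rho_{u,1},\dots,\rho_{u,N}$, of which each party holds one half. In the $N$-round test of the identity $v$ for the level $k'$, in each round $i$ the Authorizer gets a question bit $s$ and the User a question bit $t$, all $2N$ questions being independent and uniform; the Authorizer measures its half of the $i$-th pair of $v$ with a two-outcome POVM that depends on $i$ and $s$ only, with outcome $a$; the User answers a bit $b$; then $s,t,a,b$ are made public. The round is won if $s\cdot t=a\oplus b$. The Authorizer accepts if the number $W$ of rounds won satisfies $|W-\mu|<\varepsilon$, where $\mu=N\omega(C_{k'})$ and $\varepsilon=c\mu$ for a fixed $c>0$. The test is taken by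 a coalition $S$ of Users with unlimited power. It holds exactly the halves given to its members and stores them, with arbitrary ancillas, in a finite-dimensional quantum memory; in each round its answer is the outcome of an arbitrary quantum instrument on the whole memory. The instrument may depend on the public record of the earlier rounds, on all of the coalition's own questions (past and future) and on everything fixed beforehand, but not on $s$ and $a$ of the current round. Say that $c>0$ *discriminates* the levels if $(1+c)\,\omega(C_i)\le(1-c)\,\omega(C_j)$ for all $i<j$ (the acceptance windows do not overlap), and $(1+c)\,\omega(0)\le(1-c)\,\omega(C_j)$ for all $j$ with $C_j>0$. **Theorem (soundness: the protocol is unconditionally secure for the Authorizer).** 1. $\omega$ is strictly increasing on $[0,1]$, and for every pure two-qubit state of concurrence $C$ the largest probability of winning the CHSH game (uniform questions, local two-outcome POVMs) is $\omega(C)$. 2. There is $c_0>0$ such that every $c\in(0,c_0]$ discriminates the levels. 3. Let $c$ discriminate the levels, and let all pairs be pure two-qubit states, those of each User $u$ of concurrence $C_{k_u}$. Then, for all measurements of the Authorizer, every coalition $S$, every strategy of $S$, and every $v$ and $k'$ such that $k'>k_v$ if $v\in S$, and $C_{k'}>0$ if $v\notin S$, the Authorizer accepts with probability at most $2^{-c^2N/2}$.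 (With $S=\{v\}$: a User given pairs of concurrence $C_k$ does not pass for a level $k'>k$. For larger $S$: collusion and impersonation do not help.) 4. Let the pairs be arbitrary states of arbitrary finite dimension and let the Authorizer's devices be arbitrary two-outcome POVMs in each round. Suppose that for each pair of $v$ no measurement on the User's half wins the CHSH game against the Authorizer's device with probability greater than $p$, where $p\le(1-c)\,\omega(C_{k'})$ and $c>0$. Then every strategy of every coalition in the test of $v$ for $k'$ is accepted with probability at most $\exp\!\big(-2N((1-c)\omega(C_{k'})-p)^2\big)$. (If $p<\omega(C_{k'})$, the bound is exponentially small in $N$ for every $c\in(0,1-p/\omega(C_{k'}))$.) 5. The same bound holds if the two parties use black boxes with memory: in each round the physical experiment (bipartite state of arbitrary finite dimension and devices of both parties) is an arbitrary function of the record of the earlier rounds, the questions of the round are uniform and independent of that record, and each of these experiments wins the CHSH game with probability at most $p\le(1-c)\,\omega(C_{k'})$. -/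

import Mathlib

open scoped Matrix Kronecker ComplexOrder

noncomputable section

namespace QAuth

/-! ### Measurements, black boxes and the CHSH game -/

/-- A density matrix: positive semidefinite of trace one. -/
def IsDensity {n : Type*} [Fintype n] (ρ : Matrix n n ℂ) : Prop :=
  ρ.PosSemidef ∧ ρ.trace = 1

/-- A measuring device on a `d`-dimensional system with one question bit and one answer bit:
for every question `q` a two-outcome POVM `effect q false`, `effect q true`. -/
structure Measurement (d : ℕ) where
  effect : Bool → Bool → Matrix (Fin d) (Fin d) ℂ
  posSemidef : ∀ q a, (effect q a).PosSemidef
  complete : ∀ q, effect q false + effect q true = 1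

/-- Born rule: the probability of the answers `a`, `b` to the questions `s`, `t`. -/
def bornProb {dA dB : ℕ} (ρ : Matrix (Fin dA × Fin dB) (Fin dA × Fin dB) ℂ)
    (A : Measurement dA) (B : Measurement dB) (s t a b : Bool) : ℝ :=
  (ρ * (A.effect s a ⊗ₖ B.effect t b)).trace.re

/-- The winning condition `s · t = a ⊕ b` of the CHSH game. -/
def Wins (s t a b : Bool) : Prop := (s && t) = xor a b

instance (s t a b : Bool) : Decidable (Wins s t a b) := by unfold Wins; infer_instance

/-- The probability of winning the CHSH game, with uniformly distributed questions. -/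
def chshWinProb {dA dB : ℕ} (ρ : Matrix (Fin dA × Fin dB) (Fin dA × Fin dB) ℂ)
    (A : Measurement dA) (B : Measurement dB) : ℝ :=
  ∑ s : Bool, ∑ t : Bool, (1 / 4) *
    ∑ a : Bool, ∑ b : Bool, if Wins s t a b then bornProb ρ A B s t a b else 0

/-- The density matrix of a pure state. -/
def pureState {n : Type*} (ψ : n → ℂ) : Matrix n n ℂ := Matrix.vecMulVec ψ (star ψ)

/-- The Pauli `y` matrix. -/
def pauliY : Matrix (Fin 2) (Fin 2) ℂ := !![0, -Complex.I; Complex.I, 0]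

/-- The numbers `√λ₁ ≥ √λ₂ ≥ √λ₃ ≥ √λ₄`, where `λᵢ` are the eigenvalues, with multiplicity, of
`ρ (σʸ ⊗ σʸ) ρ* (σʸ ⊗ σʸ)` and `ρ*` is the entrywise complex conjugate. -/
def woottersValues (ρ : Matrix (Fin 2 × Fin 2) (Fin 2 × Fin 2) ℂ) : List ℝ :=
  ((ρ * (pauliY ⊗ₖ pauliY) * ρ.map star * (pauliY ⊗ₖ pauliY)).charpoly.roots.map
    fun z => √z.re).sort (· ≥ ·)

/-- The concurrence `max {0, √λ₁ - √λ₂ - √λ₃ - √λ₄}` of a two-qubit state. -/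
def concurrence (ρ : Matrix (Fin 2 × Fin 2) (Fin 2 × Fin 2) ℂ) : ℝ :=
  max 0 ((woottersValues ρ).getD 0 0 - (woottersValues ρ).getD 1 0
    - (woottersValues ρ).getD 2 0 - (woottersValues ρ).getD 3 0)

/-- `ω(x) = 1/2 + (1/4) √(1 + x²)`. -/
def omega (x : ℝ) : ℝ := 1 / 2 + 1 / 4 * √(1 + x ^ 2)

/-! ### The `N`-round test -/

/-- The public record of one round: the questions `s` (Authorizer) and `t` (User) and
the answers `a` (Authorizer) and `b` (User). -/
structure Round where
  s : Bool
  t : Bool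
  a : Bool
  b : Bool
  deriving DecidableEq, Fintype

/-- The number of games won in a transcript. -/
def wins {N : ℕ} (τ : Fin N → Round) : ℕ :=
  (Finset.univ.filter fun i => Wins (τ i).s (τ i).t (τ i).a (τ i).b).card

/-- The Authorizer accepts the transcript for a level of concurrence `x` iff the number of games
won lies in `(μ - ε, μ + ε)`, where `μ = N ω(x)` is the expected number for that level and
`ε = c μ`. -/
def Accepts {N : ℕ} (c x : ℝ) (τ : Fin N → Round) : Prop :=
  |(wins τ : ℝ) - N * omega x| < c * (N * omega x)

open Classical in
/-- The probability of acceptance under the transcript distribution `P`. -/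
def acceptProb {N : ℕ} (c x : ℝ) (P : (Fin N → Round) → ℝ) : ℝ :=
  ∑ τ : Fin N → Round, if Accepts c x τ then P τ else 0

/-- The relative tolerance `c` discriminates the levels of concurrence `C`: the acceptance
windows of any two levels do not overlap, and no window of an entangled level reaches down to the
(upper half of the) window around the value `ω(0)` of unentangled pairs. -/
structure Discriminates {ℓ : ℕ} (C : Fin ℓ → ℝ) (c : ℝ) : Prop where
  pos : 0 < c
  levels : ∀ i j, i < j → (1 + c) * omega (C i) ≤ (1 - c) * omega (C j)
  unentangled : ∀ j, 0 < C j → (1 + c) * omega 0 ≤ (1 - c) * omega (C j)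

/-! ### Malicious Users -/

section Coalition

variable {U : Type*} [Fintype U] [DecidableEq U] {N dA dB : ℕ}

/-- The halves held by a coalition `S` of Users: user `u` shares the pairs `(u, i)`, `i < N`, with
the Authorizer. -/
abbrev Held (S : Finset U) (N : ℕ) : Type _ := {p : U × Fin N // p.1 ∈ S}

/-- The joint state of all the Authorizer's halves and of the halves held by the coalition, when
the pairs are independent with states `ρ u i`. A pair whose other half is not held by the
coalition enters through its partial trace. -/
def sharedState (ρ : U → Fin N → Matrix (Fin dA × Fin dB) (Fin dA × Fin dB) ℂ) (S : Finset U) :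
    Matrix ((U × Fin N → Fin dA) × (Held S N → Fin dB))
      ((U × Fin N → Fin dA) × (Held S N → Fin dB)) ℂ :=
  fun z w => ∏ p : U × Fin N,
    if h : p.1 ∈ S then ρ p.1 p.2 (z.1 p, z.2 ⟨p, h⟩) (w.1 p, w.2 ⟨p, h⟩)
    else ∑ y, ρ p.1 p.2 (z.1 p, y) (w.1 p, y)

/-- A strategy of a coalition `S`. The coalition stores the halves that it holds, together with
arbitrary ancillas, in a quantum memory of arbitrary finite dimension (`prep` is an isometry).
In every round it applies to the whole memory an arbitrary quantum instrument, with the answer bit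
as classical outcome. The instrument may depend on the public record of the earlier rounds and on
the coalition's own questions `q` of all the rounds, past and future, but not on the Authorizer's
question and answer in the current round. -/
structure Strategy (S : Finset U) (N dB : ℕ) where
  dim : ℕ
  krausNum : ℕ
  prep : Matrix (Fin dim) (Held S N → Fin dB) ℂ
  isometry : prepᴴ * prep = 1
  kraus : (q : Fin N → Bool) → List Round → (b : Bool) → Fin krausNum →
    Matrix (Fin dim) (Fin dim) ℂ
  complete : ∀ q h, ∑ b : Bool, ∑ r, (kraus q h b r)ᴴ * kraus q h b r = 1

variable {S : Finset U}

/-- The unnormalised joint state after the rounds `rest`, when the record `h` precedes them. Only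
the coalition's operations are applied here. -/
def Strategy.evolve (σ : Strategy S N dB) (q : Fin N → Bool) {X : Type*} [Fintype X]
    [DecidableEq X] : List Round → List Round →
    Matrix (X × Fin σ.dim) (X × Fin σ.dim) ℂ → Matrix (X × Fin σ.dim) (X × Fin σ.dim) ℂ
  | _, [], M => M
  | h, x :: rest, M => σ.evolve q (h ++ [x]) rest
      (∑ r, ((1 : Matrix X X ℂ) ⊗ₖ σ.kraus q h x.b r) * M *
        ((1 : Matrix X X ℂ) ⊗ₖ σ.kraus q h x.b r)ᴴ)

/-- The effect on the Authorizer's halves that belongs to the transcript `τ` of a test of the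
identity `v`: in round `i` the Authorizer measures its half of the pair `(v, i)` with the device
`A i`; the other halves are not touched. -/
def authorizerEffect (v : U) (A : Fin N → Measurement dA) (τ : Fin N → Round) :
    Matrix (U × Fin N → Fin dA) (U × Fin N → Fin dA) ℂ :=
  fun x y => ∏ p : U × Fin N,
    if p.1 = v then (A p.2).effect (τ p.2).s (τ p.2).a (x p) (y p)
    else (1 : Matrix (Fin dA) (Fin dA) ℂ) (x p) (y p)

/-- The probability of the transcript `τ` when the coalition `S` follows the strategy `σ` in a test
of the identity `v`; the `2 N` questions are independent and uniformly distributed. -/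
def Strategy.transcriptProb (σ : Strategy S N dB)
    (ρ : U → Fin N → Matrix (Fin dA × Fin dB) (Fin dA × Fin dB) ℂ) (v : U)
    (A : Fin N → Measurement dA) (τ : Fin N → Round) : ℝ :=
  (1 / 4) ^ N *
    ((authorizerEffect v A τ ⊗ₖ (1 : Matrix (Fin σ.dim) (Fin σ.dim) ℂ)) *
      σ.evolve (fun i => (τ i).t) [] (List.ofFn τ)
        (((1 : Matrix (U × Fin N → Fin dA) (U × Fin N → Fin dA) ℂ) ⊗ₖ σ.prep) * sharedState ρ S *
          ((1 : Matrix (U × Fin N → Fin dA) (U × Fin N → Fin dA) ℂ) ⊗ₖ σ.prep)ᴴ)).trace.re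

end Coalition

/-! ### Black boxes with memory -/

/-- A physical experiment: a bipartite state of arbitrary finite dimension and the measuring
devices of the two parties. -/
structure Experiment where
  dA : ℕ
  dB : ℕ
  state : Matrix (Fin dA × Fin dB) (Fin dA × Fin dB) ℂ
  isDensity : IsDensity state
  alice : Measurement dA
  bob : Measurement dB

/-- The probability of the rounds `rest` after the record `h`, with uniform questions, when the
experiment carried out in each round (state and devices of both parties) is an arbitrary function
of the record of the earlier rounds. -/
def boxProb (box : List Round → Experiment) : List Round → List Round → ℝ
  | _, [] => 1
  | h, x :: rest =>
      (1 / 4) * bornProb (box h).state (box h).alice (box h).bob x.s x.t x.a x.b *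
        boxProb box (h ++ [x]) rest

end QAuth

end

noncomputable section

namespace QAuth

/-! ### Positive semidefinite matrices -/

section PosSemidef

variable {n m : Type*} [Fintype n] [Fintype m]

/-! With `r = e^l ≥ 1` the weight `r^W` of a transcript is a product over the rounds. By Chernoff's
method and Hoeffding's lemma (`acceptProb_le_exp`), acceptance is exponentially unlikely once `E r^W
≤ (1 + (r - 1) p)^N`, as if the rounds were independent and each won with probability `p`. For boxes
with memory this follows by conditioning on the record (`sum_boxProb_mul_le`).

For a coalition it is a product property of semidefinite programs. In the Heisenberg picture the
answers to a fixed list `q` of own questions give positive operators `recordEffect` on the held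
halves, and summing over the last answer gives the operator of the shorter record. The Authorizer's
measurements leave a tensor product of reward operators, one per round. By duality (`exists_dual`) a
round has operators `K t` that dominate the rewards of both answers and whose traces add up to at
most `1 + (r - 1) p`. Replacing rewards by `K` from the last round backwards removes the strategy
altogether (`sum_trace_recordEffect_mul_le`) and leaves a product of traces; the sum over `q` then
factorises. Halves outside the coalition enter only through traces, so without `v` only
deterministic answers compete, and these win with probability at most `3/4 = ω(0)`.

For pure qubit pairs the optimal `p` comes from the correlation matrix `T`, which satisfies `TᵀT =
C² 1 + s sᵀ` with `s` the Bloch vector of the second qubit and `|s|² = 1 - C²`. Cauchy-Schwarz and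
Bessel bound the CHSH expression by `2 √(1 + C²)`, and explicit directions attain this.
Discrimination of the levels is continuity at `c = 0`. -/

lemma exists_eq_conjTranspose_mul_self {A : Matrix n n ℂ} (hA : A.PosSemidef) :
    ∃ B : Matrix n n ℂ, A = Bᴴ * B := by
  classical
  open scoped MatrixOrder in
  exact CStarAlgebra.nonneg_iff_eq_star_mul_self.mp hA.nonneg

lemma trace_mul_nonneg {A B : Matrix n n ℂ} (hA : A.PosSemidef) (hB : B.PosSemidef) :
    0 ≤ (A * B).trace := by
  obtain ⟨C, rfl⟩ := exists_eq_conjTranspose_mul_self hA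
  rw [Matrix.mul_assoc, Matrix.trace_mul_comm]
  exact (hB.mul_mul_conjTranspose_same C).trace_nonneg

lemma trace_mul_le_trace_mul {A B E : Matrix n n ℂ} (hE : E.PosSemidef)
    (hAB : (B - A).PosSemidef) : (E * A).trace.re ≤ (E * B).trace.re := by
  have h := (Complex.le_def.mp (trace_mul_nonneg hE hAB)).1
  rw [Matrix.mul_sub, Matrix.trace_sub, Complex.sub_re, Complex.zero_re] at h
  linarith

/-- A Hermitian matrix `Δ` has a positive part whose trace is the expectation of `Δ` in the effect
that projects onto the positive eigenspaces. -/
lemma exists_posPart_effect [DecidableEq n] {Δ : Matrix n n ℂ} (hΔ : Δ.IsHermitian) :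
    ∃ P Q : Matrix n n ℂ, P.PosSemidef ∧ (1 - P).PosSemidef ∧ Q.PosSemidef ∧ (Q - Δ).PosSemidef ∧
      Q.trace = (Δ * P).trace := by
  set U : Matrix n n ℂ := (hΔ.eigenvectorUnitary : Matrix n n ℂ) with hU
  have hUU : Uᴴ * U = 1 := Matrix.mem_unitaryGroup_iff'.mp hΔ.eigenvectorUnitary.2
  have hUU' : U * Uᴴ = 1 := Matrix.mem_unitaryGroup_iff.mp hΔ.eigenvectorUnitary.2
  set l := hΔ.eigenvalues
  have hs : Δ = U * Matrix.diagonal (fun i => (l i : ℂ)) * Uᴴ := by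
    have := hΔ.spectral_theorem
    rw [Unitary.conjStarAlgAut_apply] at this
    exact this
  have hd : ∀ d : n → ℝ, (∀ i, 0 ≤ d i) →
      (U * Matrix.diagonal (fun i => (d i : ℂ)) * Uᴴ).PosSemidef := fun d h0 =>
    (Matrix.PosSemidef.diagonal (fun i => by simpa using h0 i)).mul_mul_conjTranspose_same U
  have h1 : (1 : Matrix n n ℂ) = U * Matrix.diagonal (fun _ => ((1 : ℝ) : ℂ)) * Uᴴ := by
    simp [hUU']
  refine ⟨U * Matrix.diagonal (fun i => ((if 0 < l i then 1 else 0 : ℝ) : ℂ)) * Uᴴ,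
    U * Matrix.diagonal (fun i => ((max (l i) 0 : ℝ) : ℂ)) * Uᴴ, ?_, ?_, ?_, ?_, ?_⟩
  · exact hd _ fun i => by split_ifs <;> norm_num
  -- In the eigenbasis of `Δ` every comparison of operators becomes one of diagonal entries.
  · nth_rw 1 [h1]
    rw [← Matrix.sub_mul, ← Matrix.mul_sub, Matrix.diagonal_sub]
    simp_rw [← Complex.ofReal_sub]
    exact hd _ fun i => by split_ifs <;> norm_num
  · exact hd _ fun i => le_max_right _ _
  · nth_rw 1 [hs]
    rw [← Matrix.sub_mul, ← Matrix.mul_sub, Matrix.diagonal_sub]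
    simp_rw [← Complex.ofReal_sub]
    exact hd _ fun i => by simp
  · conv_rhs => rw [hs]
    have : ∀ D E : Matrix n n ℂ, U * D * Uᴴ * (U * E * Uᴴ) = U * (D * E) * Uᴴ := fun D E => by
      calc U * D * Uᴴ * (U * E * Uᴴ) = U * D * (Uᴴ * U) * E * Uᴴ := by
            simp only [Matrix.mul_assoc]
        _ = _ := by rw [hUU, Matrix.mul_one, Matrix.mul_assoc U]
    rw [this, Matrix.diagonal_mul_diagonal]
    congr 5
    ext i
    split_ifs with h
    · simp [max_eq_left h.le]
    · simp [max_eq_right (not_lt.mp h)]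

end PosSemidef

/-! ### Concentration -/

/-- Hoeffding's lemma for a Bernoulli variable. -/
lemma one_add_exp_sub_one_mul_le (l p : ℝ) (h0 : 0 ≤ p) (h1 : p ≤ 1) :
    1 + (Real.exp l - 1) * p ≤ Real.exp (l * p + l ^ 2 / 8) := by
  set μ := ProbabilityTheory.bernoulliMeasure true false (⟨p, h0, h1⟩ : unitInterval)
  set X : Bool → ℝ := fun b => if b then 1 else 0
  have h := (ProbabilityTheory.hasSubgaussianMGF_of_mem_Icc (μ := μ) (X := X) (a := 0) (b := 1)
    (Measurable.of_discrete).aemeasurable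
    (Filter.Eventually.of_forall fun b => by cases b <;> simp [X])).mgf_le l
  rw [ProbabilityTheory.mgf, ProbabilityTheory.integral_bernoulliMeasure,
    ProbabilityTheory.integral_bernoulliMeasure] at h
  simp only [X, if_true, sub_zero, nnnorm_one, smul_eq_mul, Bool.false_eq_true, if_false, mul_one,
    mul_zero, add_zero] at h
  -- Factoring out `e^(lp)` centres the variable, which takes values in an interval of length one
  -- and is therefore sub-Gaussian with variance proxy `1/4`.
  have e : 1 + (Real.exp l - 1) * p = Real.exp (l * p) *
      (p * Real.exp (l * (1 - p)) + (1 - p) * Real.exp (l * (0 - p))) := by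
    rw [mul_add, mul_left_comm, ← Real.exp_add, mul_left_comm (Real.exp _), ← Real.exp_add]
    ring_nf
    simp only [Real.exp_zero]
    ring
  rw [e, Real.exp_add]
  gcongr
  refine h.trans_eq (congrArg Real.exp ?_)
  push_cast
  ring


/-- Chernoff's bound for the number of games won, when its moment generating function is dominated
by that of a binomial variable. -/
lemma acceptProb_le_exp {N : ℕ} {c p x : ℝ} (hc : 0 < c) (P : (Fin N → Round) → ℝ)
    (hP : ∀ τ, 0 ≤ P τ) (hp0 : 0 < N → 0 ≤ p) (hx1 : omega x ≤ 1) (hp : p ≤ (1 - c) * omega x)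
    (hmgf : ∀ l : ℝ, 0 ≤ l → ∑ τ, P τ * Real.exp (l * wins τ) ≤ (1 + (Real.exp l - 1) * p) ^ N) :
    acceptProb c x P ≤ Real.exp (-2 * ((1 - c) * omega x - p) ^ 2 * N) := by
  classical
  rcases Nat.eq_zero_or_pos N with rfl | hN
  -- Without rounds the strict acceptance window is empty; nothing then forces `p` to be
  -- nonnegative.
  · simp [acceptProb, Accepts, wins]
  have hp0 := hp0 hN
  set y := (1 - c) * omega x with hy
  have hω : 0 < omega x := by unfold omega; positivity
  -- This `l` minimises the exponent `-l y + l p + l²/8`.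
  set l := 4 * (y - p) with hl
  have hl0 : 0 ≤ l := by linarith
  have hp1 : p ≤ 1 := by nlinarith
  have step : acceptProb c x P ≤ ∑ τ, Real.exp (-(l * (N * y))) * (P τ * Real.exp (l * wins τ)) := by
    refine Finset.sum_le_sum fun τ _ => ?_
    split_ifs with h
    -- Only the lower end of the acceptance window is used.
    · have h' : N * y ≤ wins τ := by
        have := (abs_lt.mp h).1
        rw [hy]
        nlinarith
      have : 1 ≤ Real.exp (-(l * (N * y))) * Real.exp (l * wins τ) := by
        rw [← Real.exp_add, Real.one_le_exp_iff]
        nlinarith [mul_le_mul_of_nonneg_left h' hl0]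
      nlinarith [hP τ]
    · have := hP τ
      positivity
  refine step.trans ?_
  rw [← Finset.mul_sum]
  have h2 : (1 + (Real.exp l - 1) * p) ^ N ≤ Real.exp (l * p + l ^ 2 / 8) ^ N := by
    refine pow_le_pow_left₀ ?_ (one_add_exp_sub_one_mul_le l p hp0 hp1) N
    have : 1 ≤ Real.exp l := Real.one_le_exp hl0
    nlinarith
  refine (mul_le_mul_of_nonneg_left ((hmgf l hl0).trans h2) (Real.exp_pos _).le).trans ?_
  rw [← Real.exp_nat_mul, ← Real.exp_add]
  apply Real.exp_le_exp.mpr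
  rw [hl]
  apply le_of_eq
  ring

lemma sum_ofFn_succ {α β : Type*} [Fintype α] [AddCommMonoid β] {n : ℕ} (f : List α → β) :
    ∑ τ : Fin (n + 1) → α, f (List.ofFn τ) = ∑ x, ∑ τ : Fin n → α, f (x :: List.ofFn τ) := by
  rw [← (Fin.consEquiv fun _ => α).sum_comp, Fintype.sum_prod_type]
  simp [Fin.consEquiv, List.ofFn_succ]

lemma exp_mul_wins {N : ℕ} (l : ℝ) (τ : Fin N → Round) :
    Real.exp (l * wins τ) = ((List.ofFn τ).map fun x =>
      if Wins x.s x.t x.a x.b then Real.exp l else 1).prod := by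
  rw [List.map_ofFn, List.prod_ofFn]
  simp only [Function.comp, Finset.prod_ite, Finset.prod_const, one_pow, mul_one, wins]
  rw [mul_comm, Real.exp_nat_mul]

/-! ### Single rounds and black boxes with memory -/

lemma Round.sum_eq {β : Type*} [AddCommMonoid β] (f : Round → β) :
    ∑ x, f x = ∑ s, ∑ t, ∑ a, ∑ b, f ⟨s, t, a, b⟩ := by
  let e : Round ≃ Bool × Bool × Bool × Bool :=
    ⟨fun x => (x.s, x.t, x.a, x.b), fun y => ⟨y.1, y.2.1, y.2.2.1, y.2.2.2⟩,
      fun _ => rfl, fun _ => rfl⟩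
  rw [← e.symm.sum_comp]
  simp only [Fintype.sum_prod_type]
  rfl

section Measurement

variable {dA dB : ℕ} {ρ : Matrix (Fin dA × Fin dB) (Fin dA × Fin dB) ℂ}

lemma bornProb_nonneg (hρ : ρ.PosSemidef) (A : Measurement dA) (B : Measurement dB)
    (s t a b : Bool) : 0 ≤ bornProb ρ A B s t a b :=
  (Complex.le_def.mp <|
    trace_mul_nonneg hρ ((A.posSemidef s a).kronecker (B.posSemidef t b))).1

lemma sum_bornProb (hρ : ρ.trace = 1) (A : Measurement dA) (B : Measurement dB) (s t : Bool) :
    ∑ a, ∑ b, bornProb ρ A B s t a b = 1 := by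
  have h1 : ∑ a, ∑ b, A.effect s a ⊗ₖ B.effect t b = 1 := by
    have : ∀ a, ∑ b, A.effect s a ⊗ₖ B.effect t b = A.effect s a ⊗ₖ (1 : Matrix _ _ ℂ) := fun a => by
      rw [← B.complete t, Matrix.kronecker_add, Fintype.sum_bool, add_comm]
    simp_rw [this]
    rw [Fintype.sum_bool, ← Matrix.add_kronecker, add_comm, A.complete, Matrix.one_kronecker_one]
  simp only [bornProb, ← Complex.re_sum, ← Matrix.trace_sum, ← Finset.mul_sum]
  rw [h1, Matrix.mul_one, hρ, Complex.one_re]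

lemma chshWinProb_nonneg (hρ : ρ.PosSemidef) (A : Measurement dA) (B : Measurement dB) :
    0 ≤ chshWinProb ρ A B := by
  refine Finset.sum_nonneg fun s _ => Finset.sum_nonneg fun t _ => mul_nonneg (by norm_num) ?_
  refine Finset.sum_nonneg fun a _ => Finset.sum_nonneg fun b _ => ?_
  split_ifs
  exacts [bornProb_nonneg hρ A B s t a b, le_rfl]

/-- The moment generating function of the result of one round. -/
lemma sum_bornProb_mul_weight (hρ : ρ.trace = 1) (A : Measurement dA) (B : Measurement dB) (r : ℝ) :
    ∑ x : Round, 1 / 4 * bornProb ρ A B x.s x.t x.a x.b *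
      (if Wins x.s x.t x.a x.b then r else 1) = 1 + (r - 1) * chshWinProb ρ A B := by
  have h : ∀ s t a b, 1 / 4 * bornProb ρ A B s t a b * (if Wins s t a b then r else 1) =
      1 / 4 * bornProb ρ A B s t a b + (r - 1) *
        (1 / 4 * if Wins s t a b then bornProb ρ A B s t a b else 0) := fun s t a b => by
    split_ifs <;> ring
  rw [Round.sum_eq]
  simp only [h, Finset.sum_add_distrib, ← Finset.mul_sum, sum_bornProb hρ]
  simp only [chshWinProb, ← Finset.mul_sum]
  norm_num

end Measurement

lemma boxProb_nonneg (box : List Round → Experiment) (h l : List Round) :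
    0 ≤ boxProb box h l := by
  induction l generalizing h with
  | nil => exact zero_le_one
  | cons x l ih =>
    exact mul_nonneg (mul_nonneg (by norm_num) (bornProb_nonneg (box h).isDensity.1 _ _ _ _ _ _))
      (ih _)

/-- After the first round the process is again a box process with a longer record. The bound on the
remaining rounds is uniform in the record, so the first round contributes one independent factor. -/
lemma sum_boxProb_mul_le {box : List Round → Experiment} {p r : ℝ} (hr : 1 ≤ r)
    (hp : ∀ h, chshWinProb (box h).state (box h).alice (box h).bob ≤ p) (n : ℕ) (h : List Round) :
    ∑ τ : Fin n → Round, boxProb box h (List.ofFn τ) *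
      ((List.ofFn τ).map fun x => if Wins x.s x.t x.a x.b then r else 1).prod ≤
      (1 + (r - 1) * p) ^ n := by
  have hw : ∀ x : Round, 0 ≤ (if Wins x.s x.t x.a x.b then r else 1) := fun x => by
    split_ifs <;> linarith
  have hp0 : 0 ≤ p := (chshWinProb_nonneg (box h).isDensity.1 _ _).trans (hp h)
  induction n generalizing h with
  | zero => simp [boxProb]
  | succ n ih =>
    rw [sum_ofFn_succ fun l => boxProb box h l *
      (l.map fun x => if Wins x.s x.t x.a x.b then r else 1).prod]
    calc _ = ∑ x : Round, (1 / 4 * bornProb (box h).state (box h).alice (box h).bob x.s x.t x.a x.b *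
            (if Wins x.s x.t x.a x.b then r else 1)) *
            ∑ τ : Fin n → Round, boxProb box (h ++ [x]) (List.ofFn τ) *
            ((List.ofFn τ).map fun x => if Wins x.s x.t x.a x.b then r else 1).prod := by
          refine Finset.sum_congr rfl fun x _ => ?_
          rw [Finset.mul_sum]
          refine Finset.sum_congr rfl fun τ _ => ?_
          rw [boxProb, List.map_cons, List.prod_cons]
          ring
      _ ≤ ∑ x : Round, (1 / 4 * bornProb (box h).state (box h).alice (box h).bob x.s x.t x.a x.b *
            (if Wins x.s x.t x.a x.b then r else 1)) * (1 + (r - 1) * p) ^ n :=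
          Finset.sum_le_sum fun x _ => mul_le_mul_of_nonneg_left (ih _) (mul_nonneg (mul_nonneg
            (by norm_num) (bornProb_nonneg (box h).isDensity.1 _ _ _ _ _ _)) (hw x))
      _ = (1 + (r - 1) * chshWinProb (box h).state (box h).alice (box h).bob) *
            (1 + (r - 1) * p) ^ n := by
          rw [← Finset.sum_mul, sum_bornProb_mul_weight (box h).isDensity.2]
      _ ≤ (1 + (r - 1) * p) ^ (n + 1) := by
          rw [pow_succ']
          have : 0 ≤ r - 1 := by linarith
          have := hp h
          gcongr

lemma omega_le_one {x : ℝ} (h0 : 0 ≤ x) (h1 : x ≤ 1) : omega x ≤ 1 := by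
  have : √(1 + x ^ 2) ≤ 2 := Real.sqrt_le_iff.mpr ⟨by norm_num, by nlinarith⟩
  unfold omega
  linarith

theorem acceptProb_boxProb_le {N : ℕ} {c p x : ℝ} (hc : 0 < c) (hx0 : 0 ≤ x) (hx1 : x ≤ 1)
    (hpx : p ≤ (1 - c) * omega x) (box : List Round → Experiment)
    (hp : ∀ h, chshWinProb (box h).state (box h).alice (box h).bob ≤ p) :
    acceptProb c x (fun τ : Fin N → Round => boxProb box [] (List.ofFn τ)) ≤
      Real.exp (-2 * ((1 - c) * omega x - p) ^ 2 * N) := by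
  refine acceptProb_le_exp hc _ (fun τ => boxProb_nonneg _ _ _)
    (fun _ => (chshWinProb_nonneg (box []).isDensity.1 _ _).trans (hp [])) (omega_le_one hx0 hx1) hpx
    fun l hl => ?_
  simp_rw [exp_mul_wins]
  exact sum_boxProb_mul_le (Real.one_le_exp hl) hp N []

/-! ### Reduced operators -/

section Reduced

variable {X Y Z : Type*} [Fintype X] [Fintype Y] [Fintype Z]

/-- The unnormalised state of the second system after the effect `E` on the first one. -/
def reduced (ρ : Matrix (X × Y) (X × Y) ℂ) (E : Matrix X X ℂ) : Matrix Y Y ℂ :=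
  fun y y' => ∑ x, ∑ x', E x x' * ρ (x', y) (x, y')

/-- This is what `reduced` is for: the Authorizer's side is traced out once and for all, and only
operators on the User's side remain. -/
lemma trace_kronecker_mul (ρ : Matrix (X × Y) (X × Y) ℂ) (E : Matrix X X ℂ) (F : Matrix Y Y ℂ) :
    ((E ⊗ₖ F) * ρ).trace = (F * reduced ρ E).trace := by
  simp only [Matrix.trace, Matrix.diag, Matrix.mul_apply, reduced, Matrix.kronecker_apply,
    Fintype.sum_prod_type, Finset.mul_sum]
  rw [Finset.sum_comm]
  refine Finset.sum_congr rfl fun y _ => ?_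
  simp_rw [Finset.sum_comm (s := (Finset.univ : Finset X)) (t := (Finset.univ : Finset Y))]
  exact Finset.sum_congr rfl fun y' _ => Finset.sum_congr rfl fun x _ =>
    Finset.sum_congr rfl fun x' _ => by ring

lemma reduced_posSemidef {ρ : Matrix (X × Y) (X × Y) ℂ} {E : Matrix X X ℂ} (hρ : ρ.PosSemidef)
    (hE : E.PosSemidef) : (reduced ρ E).PosSemidef := by
  refine Matrix.PosSemidef.of_dotProduct_mulVec_nonneg ?_ fun v => ?_
  · ext y y'
    simp only [Matrix.conjTranspose_apply, reduced, star_sum, star_mul']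
    rw [Finset.sum_comm]
    exact Finset.sum_congr rfl fun x _ => Finset.sum_congr rfl fun x' _ => by
      rw [hE.1.apply, hρ.1.apply]
  -- The quadratic form at `v` is the expectation of `E ⊗ v v*`.
  · have h := trace_mul_nonneg (hE.kronecker (Matrix.posSemidef_vecMulVec_self_star v)) hρ
    rwa [trace_kronecker_mul, Matrix.vecMulVec_mul, Matrix.trace_vecMulVec, dotProduct_comm,
      ← Matrix.dotProduct_mulVec] at h

lemma trace_reduced_one [DecidableEq X] (ρ : Matrix (X × Y) (X × Y) ℂ) :
    (reduced ρ 1).trace = ρ.trace := by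
  simp only [Matrix.trace, Matrix.diag, reduced, Matrix.one_apply, ite_mul, one_mul, zero_mul,
    Finset.sum_ite_eq, Finset.mem_univ, if_true, Fintype.sum_prod_type]
  exact Finset.sum_comm

end Reduced

lemma bornProb_eq {dA dB : ℕ} (ρ : Matrix (Fin dA × Fin dB) (Fin dA × Fin dB) ℂ)
    (A : Measurement dA) (B : Measurement dB) (s t a b : Bool) :
    bornProb ρ A B s t a b = (reduced ρ (A.effect s a) * B.effect t b).trace.re := by
  rw [bornProb, Matrix.trace_mul_comm, trace_kronecker_mul, Matrix.trace_mul_comm]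

/-! ### Operators of product form on the halves held by a coalition -/

/-- Positivity of an operator on a half of a pair, or of its trace if the half is not held. -/
def PosOn {n : Type*} [Fintype n] (held : Prop) (X : Matrix n n ℂ) : Prop :=
  (held → X.PosSemidef) ∧ (¬held → 0 ≤ X.trace)

lemma _root_.Matrix.PosSemidef.posOn {n : Type*} [Fintype n] {X : Matrix n n ℂ}
    (hX : X.PosSemidef) (held : Prop) : PosOn held X :=
  ⟨fun _ => hX, fun _ => hX.trace_nonneg⟩

lemma PosOn.trace_nonneg {n : Type*} [Fintype n] {X : Matrix n n ℂ} {held : Prop}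
    (hX : PosOn held X) : 0 ≤ X.trace := by
  by_cases h : held
  exacts [(hX.1 h).trace_nonneg, hX.2 h]

section Tensor

variable {U : Type*} {N d : ℕ} (S : Finset U)

open Classical in
/-- A matrix entry of an operator on a held half, the trace if the half is not held. -/
def slot (y y' : Held S N → Fin d) (p : U × Fin N) (X : Matrix (Fin d) (Fin d) ℂ) : ℂ :=
  if h : p.1 ∈ S then X (y ⟨p, h⟩) (y' ⟨p, h⟩) else X.trace

variable {S}

lemma slot_smul (y y' : Held S N → Fin d) (p : U × Fin N) (c : ℂ) (X : Matrix (Fin d) (Fin d) ℂ) :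
    slot S y y' p (c • X) = c * slot S y y' p X := by
  unfold slot
  split_ifs <;> simp

lemma slot_sum (y y' : Held S N → Fin d) (p : U × Fin N) {ι : Type*} (s : Finset ι)
    (X : ι → Matrix (Fin d) (Fin d) ℂ) :
    slot S y y' p (∑ i ∈ s, X i) = ∑ i ∈ s, slot S y y' p (X i) := by
  unfold slot
  split_ifs
  · rw [Matrix.sum_apply]
  · rw [Matrix.trace_sum]

lemma slot_sub (y y' : Held S N → Fin d) (p : U × Fin N) (X X' : Matrix (Fin d) (Fin d) ℂ) :
    slot S y y' p (X - X') = slot S y y' p X - slot S y y' p X' := by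
  unfold slot
  split_ifs <;> simp

variable [Fintype U]

/-- The tensor product of operators on the halves of all pairs, those that are not held entering
through their traces. -/
def tensor (S : Finset U) (F : U × Fin N → Matrix (Fin d) (Fin d) ℂ) :
    Matrix (Held S N → Fin d) (Held S N → Fin d) ℂ :=
  fun y y' => ∏ p, slot S y y' p (F p)

lemma tensor_smul (c : U × Fin N → ℂ) (F : U × Fin N → Matrix (Fin d) (Fin d) ℂ) :
    tensor S (fun p => c p • F p) = (∏ p, c p) • tensor S F := by
  ext y y'
  simp [tensor, slot_smul, Finset.prod_mul_distrib]

variable [DecidableEq U]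

/-- Isolates the factor of one pair, so that linearity of `tensor` in each argument reduces to
linearity of `slot`. -/
lemma tensor_update_apply (F : U × Fin N → Matrix (Fin d) (Fin d) ℂ) (p : U × Fin N)
    (X : Matrix (Fin d) (Fin d) ℂ) (y y' : Held S N → Fin d) :
    tensor S (Function.update F p X) y y' =
      slot S y y' p X * ∏ p' ∈ Finset.univ.erase p, slot S y y' p' (F p') := by
  rw [tensor, ← Finset.mul_prod_erase _ _ (Finset.mem_univ p), Function.update_self]
  congr 1
  refine Finset.prod_congr rfl fun p' hp' => ?_
  rw [Function.update_of_ne (Finset.ne_of_mem_erase hp')]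

lemma tensor_update_sum (F : U × Fin N → Matrix (Fin d) (Fin d) ℂ) (p : U × Fin N) {ι : Type*}
    (s : Finset ι) (X : ι → Matrix (Fin d) (Fin d) ℂ) :
    tensor S (Function.update F p (∑ i ∈ s, X i)) =
      ∑ i ∈ s, tensor S (Function.update F p (X i)) := by
  ext y y'
  simp only [tensor_update_apply, Matrix.sum_apply, slot_sum, Finset.sum_mul]

lemma tensor_update_sub (F : U × Fin N → Matrix (Fin d) (Fin d) ℂ) (p : U × Fin N)
    (X X' : Matrix (Fin d) (Fin d) ℂ) :
    tensor S (Function.update F p (X - X')) =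
      tensor S (Function.update F p X) - tensor S (Function.update F p X') := by
  ext y y'
  simp only [tensor_update_apply, Matrix.sub_apply, slot_sub, sub_mul]

lemma tensor_apply_eq_mul (F : U × Fin N → Matrix (Fin d) (Fin d) ℂ) (y y' : Held S N → Fin d) :
    tensor S F y y' = (∏ p : Held S N, F p (y p) (y' p)) *
      ∏ p : {p : U × Fin N // p.1 ∉ S}, (F p).trace := by
  rw [tensor, ← Fintype.prod_subtype_mul_prod_subtype fun p : U × Fin N => p.1 ∈ S]
  congr 1
  · exact Finset.prod_congr rfl fun p _ => by simp [slot, p.2]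
  · exact Finset.prod_congr rfl fun p _ => by simp [slot, p.2]

lemma trace_tensor (F : U × Fin N → Matrix (Fin d) (Fin d) ℂ) :
    (tensor S F).trace = ∏ p, (F p).trace := by
  simp only [Matrix.trace, Matrix.diag, tensor_apply_eq_mul, ← Finset.sum_mul]
  rw [← Fintype.prod_subtype_mul_prod_subtype fun p : U × Fin N => p.1 ∈ S]
  congr 1
  rw [Finset.prod_univ_sum, Fintype.piFinset_univ]

/-- Write each held factor as `Gᴴ G`; the product of the `G` is a square root of the held part, and
the halves that are not held contribute a nonnegative scalar. -/
lemma tensor_posSemidef {F : U × Fin N → Matrix (Fin d) (Fin d) ℂ}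
    (hF : ∀ p, PosOn (p.1 ∈ S) (F p)) : (tensor S F).PosSemidef := by
  choose G hG using fun p : Held S N => exists_eq_conjTranspose_mul_self ((hF p).1 p.2)
  let T : Matrix (Held S N → Fin d) (Held S N → Fin d) ℂ := fun z y => ∏ p, G p (z p) (y p)
  have h : tensor S F = (∏ p : {p : U × Fin N // p.1 ∉ S}, (F p).trace) • (Tᴴ * T) := by
    ext y y'
    rw [tensor_apply_eq_mul, mul_comm, Matrix.smul_apply, smul_eq_mul]
    congr 1
    simp only [hG, Matrix.mul_apply, Matrix.conjTranspose_apply, Finset.prod_univ_sum,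
      Fintype.piFinset_univ, Finset.prod_mul_distrib]
    simp only [T, star_prod]
  rw [h]
  exact (Matrix.posSemidef_conjTranspose_mul_self T).smul
    (Finset.prod_nonneg fun p _ => (hF p).2 p.2)

/-- By linearity the difference is the tensor product with `X' - X` in the slot `p`. Domination in
one slot thus lifts to the whole product, because the other slots are positive. -/
lemma tensor_update_sub_posSemidef {F : U × Fin N → Matrix (Fin d) (Fin d) ℂ}
    (hF : ∀ p, PosOn (p.1 ∈ S) (F p)) {p : U × Fin N} {X X' : Matrix (Fin d) (Fin d) ℂ}
    (hX : PosOn (p.1 ∈ S) (X' - X)) :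
    (tensor S (Function.update F p X') - tensor S (Function.update F p X)).PosSemidef := by
  rw [← tensor_update_sub]
  refine tensor_posSemidef fun p' => ?_
  rcases eq_or_ne p' p with rfl | h
  · rwa [Function.update_self]
  · rw [Function.update_of_ne h]
    exact hF p'

end Tensor

/-! ### Strategies in the Heisenberg picture -/

section Heisenberg

variable {U : Type*} [Fintype U] [DecidableEq U] {N d : ℕ} {S : Finset U}

/-- The operations of the rounds `rest` after the record `h`, applied to an effect. -/
def Strategy.heisenberg (σ : Strategy S N d) (q : Fin N → Bool) : List Round → List Round →
    Matrix (Fin σ.dim) (Fin σ.dim) ℂ → Matrix (Fin σ.dim) (Fin σ.dim) ℂ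
  | _, [], F => F
  | h, x :: rest, F => ∑ r, (σ.kraus q h x.b r)ᴴ * σ.heisenberg q (h ++ [x]) rest F *
      σ.kraus q h x.b r

lemma trace_one_kronecker_conj {X Y Z : Type*} [Fintype X] [Fintype Y] [Fintype Z] [DecidableEq X]
    (E : Matrix X X ℂ) (F : Matrix Z Z ℂ) (K : Matrix Z Y ℂ) (M : Matrix (X × Y) (X × Y) ℂ) :
    ((E ⊗ₖ F) * (((1 : Matrix X X ℂ) ⊗ₖ K) * M * ((1 : Matrix X X ℂ) ⊗ₖ K)ᴴ)).trace =
      ((E ⊗ₖ (Kᴴ * F * K)) * M).trace := by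
  rw [← Matrix.mul_assoc, Matrix.trace_mul_comm, Matrix.conjTranspose_kronecker, ← Matrix.mul_assoc,
    ← Matrix.mul_assoc, Matrix.conjTranspose_one, ← Matrix.mul_kronecker_mul,
    ← Matrix.mul_kronecker_mul, Matrix.one_mul, Matrix.mul_one]

/-- Moving the instruments onto the effect separates the strategy from the state, which keeps its
product form. -/
lemma Strategy.trace_evolve (σ : Strategy S N d) (q : Fin N → Bool) {X : Type*} [Fintype X]
    [DecidableEq X] (E : Matrix X X ℂ) (F : Matrix (Fin σ.dim) (Fin σ.dim) ℂ) (l h : List Round)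
    (M : Matrix (X × Fin σ.dim) (X × Fin σ.dim) ℂ) :
    ((E ⊗ₖ F) * σ.evolve q h l M).trace = ((E ⊗ₖ σ.heisenberg q h l F) * M).trace := by
  induction l generalizing h M with
  | nil => rfl
  | cons x l ih =>
    have hk : ∀ G : Fin σ.krausNum → Matrix (Fin σ.dim) (Fin σ.dim) ℂ,
        E ⊗ₖ (∑ r, G r) = ∑ r, E ⊗ₖ G r := fun G =>
      map_sum (AddMonoidHom.mk' (fun G => E ⊗ₖ G) fun _ _ => Matrix.kronecker_add _ _ _) _ _
    rw [evolve, ih, heisenberg, hk, Matrix.mul_sum, Matrix.sum_mul, Matrix.trace_sum,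
      Matrix.trace_sum]
    exact Finset.sum_congr rfl fun r _ => trace_one_kronecker_conj _ _ _ _

/-- The recursion peels off the first round, but causality concerns the last one; in the Heisenberg
picture its instrument acts innermost. -/
lemma Strategy.heisenberg_append (σ : Strategy S N d) (q : Fin N → Bool) (l h : List Round)
    (x : Round) (F : Matrix (Fin σ.dim) (Fin σ.dim) ℂ) :
    σ.heisenberg q h (l ++ [x]) F = σ.heisenberg q h l
      (∑ r, (σ.kraus q (h ++ l) x.b r)ᴴ * F * σ.kraus q (h ++ l) x.b r) := by
  induction l generalizing h with
  | nil => simp [heisenberg]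
  | cons y l ih => simp [heisenberg, ih]

lemma Strategy.heisenberg_sum (σ : Strategy S N d) (q : Fin N → Bool) (l h : List Round)
    {ι : Type*} (s : Finset ι) (F : ι → Matrix (Fin σ.dim) (Fin σ.dim) ℂ) :
    σ.heisenberg q h l (∑ i ∈ s, F i) = ∑ i ∈ s, σ.heisenberg q h l (F i) := by
  induction l generalizing h with
  | nil => rfl
  | cons y l ih =>
    simp only [heisenberg, ih, Matrix.mul_sum, Matrix.sum_mul]
    exact Finset.sum_comm

lemma Strategy.heisenberg_posSemidef (σ : Strategy S N d) (q : Fin N → Bool) (l h : List Round)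
    {F : Matrix (Fin σ.dim) (Fin σ.dim) ℂ} (hF : F.PosSemidef) :
    (σ.heisenberg q h l F).PosSemidef := by
  induction l generalizing h with
  | nil => exact hF
  | cons y l ih =>
    exact Matrix.posSemidef_sum _ fun r _ => (ih _).conjTranspose_mul_mul_same _

/-- The effect on the halves held by the coalition that belongs to the answers in a record. -/
def Strategy.recordEffect (σ : Strategy S N d) (q : Fin N → Bool) (h : List Round) :
    Matrix (Held S N → Fin d) (Held S N → Fin d) ℂ :=
  σ.prepᴴ * σ.heisenberg q [] h 1 * σ.prep

lemma Strategy.recordEffect_posSemidef (σ : Strategy S N d) (q : Fin N → Bool) (h : List Round) :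
    (σ.recordEffect q h).PosSemidef :=
  (σ.heisenberg_posSemidef q h [] Matrix.PosSemidef.one).conjTranspose_mul_mul_same _

lemma Strategy.recordEffect_nil (σ : Strategy S N d) (q : Fin N → Bool) :
    σ.recordEffect q [] = 1 := by
  rw [recordEffect, heisenberg, Matrix.mul_one, σ.isometry]

/-- The effects are causal: that of the last round depends on the answer of the coalition only. -/
lemma Strategy.recordEffect_append_congr (σ : Strategy S N d) (q : Fin N → Bool) (h : List Round)
    {x y : Round} (hxy : x.b = y.b) : σ.recordEffect q (h ++ [x]) = σ.recordEffect q (h ++ [y]) := by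
  simp only [recordEffect, heisenberg_append, hxy]

/-- Completeness of the last instrument collapses the innermost sum to the identity. -/
lemma Strategy.sum_recordEffect_append (σ : Strategy S N d) (q : Fin N → Bool) (h : List Round)
    (s t a : Bool) : ∑ b, σ.recordEffect q (h ++ [⟨s, t, a, b⟩]) = σ.recordEffect q h := by
  simp only [recordEffect, heisenberg_append, Matrix.mul_one]
  rw [← Matrix.sum_mul, ← Matrix.mul_sum, ← heisenberg_sum]
  simp only [List.nil_append, σ.complete]

end Heisenberg

/-! ### Adaptive answers to a sequence of independent questions -/

section Adaptive

variable {U : Type*} [DecidableEq U] {N d : ℕ} {S : Finset U}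

/-- The operators on the halves after the record `h` of a test of the identity `v`: `r i x` on the
half `(v, i)` if `x` is the record of round `i`, and `K i` if this round is still to come. -/
def recordOps (v : U) (r : Fin N → Round → Matrix (Fin d) (Fin d) ℂ)
    (K : Fin N → Matrix (Fin d) (Fin d) ℂ) (F : U × Fin N → Matrix (Fin d) (Fin d) ℂ)
    (h : List Round) (p : U × Fin N) : Matrix (Fin d) (Fin d) ℂ :=
  if p.1 = v then (h[(p.2 : ℕ)]?).elim (K p.2) (r p.2) else F p

/-- A new round replaces `K` by a reward in exactly one slot, which is what lets the rounds be
treated one at a time. -/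
lemma recordOps_append (v : U) (r : Fin N → Round → Matrix (Fin d) (Fin d) ℂ)
    (K : Fin N → Matrix (Fin d) (Fin d) ℂ) (F : U × Fin N → Matrix (Fin d) (Fin d) ℂ)
    (h : List Round) (hN : h.length < N) (x : Round) :
    recordOps v r K F (h ++ [x]) =
      Function.update (recordOps v r K F h) (v, ⟨h.length, hN⟩) (r ⟨h.length, hN⟩ x) := by
  ext1 ⟨u, i⟩
  by_cases hu : u = v
  · subst hu
    by_cases hi : i = ⟨h.length, hN⟩
    · subst hi
      simp [recordOps]
    · have hi' : (i : ℕ) ≠ h.length := fun h' => hi (Fin.ext h')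
      rw [Function.update_of_ne (by simpa using hi)]
      simp only [recordOps, if_true]
      congr 1
      rcases lt_or_gt_of_ne hi' with h' | h'
      · rw [List.getElem?_append_left h']
      · rw [List.getElem?_eq_none (by simp; omega), List.getElem?_eq_none h'.le]
  · rw [Function.update_of_ne (by simp [hu])]
    simp [recordOps, hu]

lemma recordOps_update_self (v : U) (r : Fin N → Round → Matrix (Fin d) (Fin d) ℂ)
    (K : Fin N → Matrix (Fin d) (Fin d) ℂ) (F : U × Fin N → Matrix (Fin d) (Fin d) ℂ)
    (h : List Round) (hN : h.length < N) :
    Function.update (recordOps v r K F h) (v, ⟨h.length, hN⟩) (K ⟨h.length, hN⟩) =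
      recordOps v r K F h := by
  rw [Function.update_eq_self_iff]
  simp [recordOps]

lemma recordOps_posOn {v : U} {r : Fin N → Round → Matrix (Fin d) (Fin d) ℂ}
    {K : Fin N → Matrix (Fin d) (Fin d) ℂ} {F : U × Fin N → Matrix (Fin d) (Fin d) ℂ}
    (hr : ∀ i x, PosOn (v ∈ S) (r i x)) (hK : ∀ i, PosOn (v ∈ S) (K i))
    (hF : ∀ p, PosOn (p.1 ∈ S) (F p)) (h : List Round) (p : U × Fin N) :
    PosOn (p.1 ∈ S) (recordOps v r K F h p) := by
  unfold recordOps
  split_ifs with hp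
  · rw [hp]
    cases h[(p.2 : ℕ)]?
    exacts [hK _, hr _ _]
  · exact hF p

variable [Fintype U]

/-- If in every round the operators `r` of each answer add up to at most `K`, an adaptive strategy
achieves at most the product of the traces of the `K`. -/
lemma Strategy.sum_trace_recordEffect_mul_le (σ : Strategy S N d) (q : Fin N → Bool) {v : U}
    {r : Fin N → Round → Matrix (Fin d) (Fin d) ℂ}
    {K : Fin N → Matrix (Fin d) (Fin d) ℂ} {F : U × Fin N → Matrix (Fin d) (Fin d) ℂ}
    (hr : ∀ i x, PosOn (v ∈ S) (r i x)) (hK : ∀ i, PosOn (v ∈ S) (K i))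
    (hF : ∀ p, PosOn (p.1 ∈ S) (F p))
    (hrK : ∀ i b, PosOn (v ∈ S) (K i - ∑ s, ∑ t, ∑ a, r i ⟨s, t, a, b⟩))
    (n : ℕ) (h : List Round) (hn : h.length + n = N) :
    ∑ τ : Fin n → Round, (σ.recordEffect q (h ++ List.ofFn τ) *
        tensor S (recordOps v r K F (h ++ List.ofFn τ))).trace.re ≤
      (σ.recordEffect q h * tensor S (recordOps v r K F h)).trace.re := by
  induction n generalizing h with
  | zero => simp
  | succ n ih =>
    have hN : h.length < N := by omega
    set G := recordOps v r K F h with hG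
    set i : Fin N := ⟨h.length, hN⟩ with hi
    -- The three values `false` are placeholders: by causality only the answer bit of the last round
    -- matters.
    set E' : Bool → Matrix (Held S N → Fin d) (Held S N → Fin d) ℂ := fun b =>
      σ.recordEffect q (h ++ [⟨false, false, false, b⟩]) with hE'
    rw [sum_ofFn_succ fun l => (σ.recordEffect q (h ++ l) *
        tensor S (recordOps v r K F (h ++ l))).trace.re]
    calc _ ≤ ∑ x, (σ.recordEffect q (h ++ [x]) *
            tensor S (recordOps v r K F (h ++ [x]))).trace.re := by
          refine Finset.sum_le_sum fun x _ => ?_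
          have := ih (h ++ [x]) (by simp; omega)
          simpa only [List.append_assoc, List.singleton_append] using this
      _ = ∑ x : Round, (E' x.b * tensor S (Function.update G (v, i) (r i x))).trace.re := by
          refine Finset.sum_congr rfl fun x _ => ?_
          rw [recordOps_append v r K F h hN, hE']
          dsimp only
          rw [σ.recordEffect_append_congr q h (x := x) (y := ⟨false, false, false, x.b⟩) rfl, hG, hi]
      -- Since the effect depends on `b` only, the sums over `s`, `t`, `a` pass into the slot of
      -- this round.
      _ = ∑ b, (E' b * tensor S (Function.update G (v, i)
            (∑ s, ∑ t, ∑ a, r i ⟨s, t, a, b⟩))).trace.re := by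
          rw [Round.sum_eq]
          simp only [tensor_update_sum, Matrix.mul_sum, Matrix.trace_sum, Complex.re_sum]
          simp only [Fintype.sum_bool]
          ring
      _ ≤ ∑ b, (E' b * tensor S (Function.update G (v, i) (K i))).trace.re :=
          Finset.sum_le_sum fun b _ => trace_mul_le_trace_mul (σ.recordEffect_posSemidef q _)
            (tensor_update_sub_posSemidef (recordOps_posOn hr hK hF h) (hrK i b))
      -- The slot no longer depends on `b`, so the effects of the round add up to that of `h`.
      _ = _ := by
          rw [recordOps_update_self, ← Complex.re_sum, ← Matrix.trace_sum, ← Matrix.sum_mul,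
            σ.sum_recordEffect_append]

lemma trace_tensor_recordOps_nil {v : U} {r : Fin N → Round → Matrix (Fin d) (Fin d) ℂ}
    {K : Fin N → Matrix (Fin d) (Fin d) ℂ} {F : U × Fin N → Matrix (Fin d) (Fin d) ℂ}
    (hF : ∀ p, (F p).trace = 1) :
    (tensor S (recordOps v r K F [])).trace = ∏ i, (K i).trace := by
  rw [trace_tensor, Fintype.prod_prod_type, Finset.prod_eq_single v]
  · simp [recordOps]
  · intro u _ hu
    simp [recordOps, hu, hF]
  · simp

end Adaptive

/-! ### The optimal answer in a single round -/

section SingleRound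

variable {dA dB : ℕ}

/-- The device that answers the question `t` with `f t`. -/
def Measurement.deterministic (d : ℕ) (f : Bool → Bool) : Measurement d where
  effect t b := if b = f t then 1 else 0
  posSemidef t b := by
    split_ifs
    exacts [Matrix.PosSemidef.one, Matrix.PosSemidef.zero]
  complete t := by cases f t <;> simp

/-- The reward for the answer `b` to the question `t` as an operator on the User's half, if a round
that is won counts `r` and a round that is lost counts `1`. -/
def answerOp (ρ : Matrix (Fin dA × Fin dB) (Fin dA × Fin dB) ℂ) (A : Measurement dA) (r : ℝ)
    (t b : Bool) : Matrix (Fin dB) (Fin dB) ℂ :=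
  ∑ s, ∑ a, ((1 / 4 * if Wins s t a b then r else 1 : ℝ) : ℂ) • reduced ρ (A.effect s a)

variable {ρ : Matrix (Fin dA × Fin dB) (Fin dA × Fin dB) ℂ} {r : ℝ}

lemma smul_reduced_posSemidef (hρ : ρ.PosSemidef) (A : Measurement dA) {c : ℝ} (hc : 0 ≤ c)
    (s a : Bool) : ((c : ℂ) • reduced ρ (A.effect s a)).PosSemidef :=
  (reduced_posSemidef hρ (A.posSemidef s a)).smul (by exact_mod_cast hc)

lemma answerOp_posSemidef (hρ : ρ.PosSemidef) (A : Measurement dA) (hr : 1 ≤ r) (t b : Bool) :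
    (answerOp ρ A r t b).PosSemidef := by
  refine Matrix.posSemidef_sum _ fun s _ => Matrix.posSemidef_sum _ fun a _ =>
    smul_reduced_posSemidef hρ A ?_ s a
  split_ifs <;> linarith

/-- The primal objective: the expected reward when the User answers with the device `B`. -/
lemma sum_trace_answerOp_mul (hρ : ρ.trace = 1) (A : Measurement dA) (B : Measurement dB) (r : ℝ) :
    ∑ t, ∑ b, (answerOp ρ A r t b * B.effect t b).trace.re =
      1 + (r - 1) * chshWinProb ρ A B := by
  rw [← sum_bornProb_mul_weight hρ, Round.sum_eq]
  simp only [answerOp, Matrix.add_mul, Matrix.trace_add, Complex.add_re, Matrix.smul_mul,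
    Matrix.trace_smul, smul_eq_mul, Complex.re_ofReal_mul, bornProb_eq, Fintype.sum_bool]
  ring

/-- Operators that dominate the rewards of both answers, with minimal total trace. -/
lemma exists_dual (held : Prop) (hρ : IsDensity ρ) (A : Measurement dA) (hr : 1 ≤ r) {p : ℝ}
    (hp : held → ∀ B : Measurement dB, chshWinProb ρ A B ≤ p)
    (hp' : ¬held → ∀ f, chshWinProb ρ A (Measurement.deterministic dB f) ≤ p) :
    ∃ K : Bool → Matrix (Fin dB) (Fin dB) ℂ, (∀ t, PosOn held (K t)) ∧
      (∀ t b, PosOn held (K t - answerOp ρ A r t b)) ∧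
      ∑ t, (K t).trace.re ≤ 1 + (r - 1) * p := by
  have hR := fun t b => answerOp_posSemidef hρ.1 A hr t b
  by_cases h : held
  -- With `Δ` the reward of `false` minus that of `true`, the reward of `true` plus the positive
  -- part of `Δ` dominates both. Its trace is the reward of the Helstrom measurement, which answers
  -- `false` on the positive eigenspaces, so the bound on measurements bounds the dual value.
  · choose P Q hP hP1 hQ hQR hPQ using fun t =>
      exists_posPart_effect ((hR t false).1.sub (hR t true).1)
    let B : Measurement dB := ⟨fun t b => if b then 1 - P t else P t,
      fun t b => by cases b; exacts [hP t, hP1 t], fun t => by simp⟩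
    refine ⟨fun t => answerOp ρ A r t true + Q t, fun t => ((hR t true).add (hQ t)).posOn _,
      fun t b => ?_, ?_⟩
    · refine Matrix.PosSemidef.posOn ?_ _
      cases b
      · have := hQR t
        rwa [sub_sub_eq_add_sub, add_comm] at this
      · simpa using hQ t
    · have hv := sum_trace_answerOp_mul hρ.2 A B r
      have : ∀ t, (answerOp ρ A r t true + Q t).trace.re =
          ∑ b, (answerOp ρ A r t b * B.effect t b).trace.re := fun t => by
        rw [Matrix.trace_add, hPQ, Fintype.sum_bool]
        simp only [B, if_true, Bool.false_eq_true, if_false, Matrix.mul_sub, Matrix.sub_mul,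
          Matrix.mul_one, Matrix.trace_sub, Complex.sub_re, Complex.add_re]
        ring
      simp_rw [this, hv]
      have := hp h B
      nlinarith
  -- Without the half only traces are compared, and the best answer to each question is
  -- deterministic.
  · let f : Bool → Bool := fun t =>
      decide ((answerOp ρ A r t false).trace.re ≤ (answerOp ρ A r t true).trace.re)
    refine ⟨fun t => answerOp ρ A r t (f t), fun t => (hR t _).posOn _, fun t b =>
      ⟨fun h' => absurd h' h, fun _ => ?_⟩, ?_⟩
    · have h1 : (answerOp ρ A r t b).trace.re ≤ (answerOp ρ A r t (f t)).trace.re := by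
        by_cases hf : (answerOp ρ A r t false).trace.re ≤ (answerOp ρ A r t true).trace.re
        · have : f t = true := by simp [f, hf]
          rw [this]
          cases b
          exacts [hf, le_rfl]
        · have : f t = false := by simp only [f, hf, decide_false]
          rw [this]
          cases b
          exacts [le_rfl, (not_le.mp hf).le]
      rw [Matrix.trace_sub, sub_nonneg]
      exact Complex.le_def.mpr ⟨h1, by
        rw [← (Complex.le_def.mp (hR t b).trace_nonneg).2,
          ← (Complex.le_def.mp (hR t (f t)).trace_nonneg).2]⟩
    · have hv := sum_trace_answerOp_mul hρ.2 A (Measurement.deterministic dB f) r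
      have : ∀ t, (answerOp ρ A r t (f t)).trace.re =
          ∑ b, (answerOp ρ A r t b * (Measurement.deterministic dB f).effect t b).trace.re :=
        fun t => by
          rw [Finset.sum_eq_single (f t)]
          · simp [Measurement.deterministic]
          · intro b _ hb
            simp [Measurement.deterministic, hb]
          · simp
      simp_rw [this, hv]
      have := hp' h f
      nlinarith

end SingleRound

/-! ### Security against coalitions -/

section Coalition

variable {U : Type*} [Fintype U] [DecidableEq U] {N dA dB : ℕ} {S : Finset U}
  {ρ : U → Fin N → Matrix (Fin dA × Fin dB) (Fin dA × Fin dB) ℂ}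

/-- State and effect are both products over the pairs, so the sums factorise. The choice of `K` is
immaterial since a full transcript leaves no round to come. -/
lemma reduced_sharedState (v : U) (A : Fin N → Measurement dA) (τ : Fin N → Round)
    (K : Fin N → Matrix (Fin dB) (Fin dB) ℂ) :
    reduced (sharedState ρ S) (authorizerEffect v A τ) =
      tensor S (recordOps v (fun i x => reduced (ρ v i) ((A i).effect x.s x.a)) K
        (fun p => reduced (ρ p.1 p.2) 1) (List.ofFn τ)) := by
  have hops : ∀ p : U × Fin N, recordOps v (fun i x => reduced (ρ v i) ((A i).effect x.s x.a)) K
      (fun p => reduced (ρ p.1 p.2) 1) (List.ofFn τ) p = reduced (ρ p.1 p.2)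
        (if p.1 = v then (A p.2).effect (τ p.2).s (τ p.2).a else 1) := fun p => by
    unfold recordOps
    split_ifs with h
    · simp [h]
    · rfl
  ext y y'
  change ∑ x, ∑ x', authorizerEffect v A τ x x' * sharedState ρ S (x', y) (x, y') =
    ∏ p, slot S y y' p (recordOps _ _ _ _ _ p)
  have hslot : ∀ p : U × Fin N, slot S y y' p (reduced (ρ p.1 p.2)
      (if p.1 = v then (A p.2).effect (τ p.2).s (τ p.2).a else 1)) =
      ∑ x, ∑ x', (if p.1 = v then (A p.2).effect (τ p.2).s (τ p.2).a x x'
        else (1 : Matrix (Fin dA) (Fin dA) ℂ) x x') *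
        (if h : p.1 ∈ S then ρ p.1 p.2 (x', y ⟨p, h⟩) (x, y' ⟨p, h⟩)
          else ∑ z, ρ p.1 p.2 (x', z) (x, z)) := fun p => by
    have hite : ∀ x x', (if p.1 = v then (A p.2).effect (τ p.2).s (τ p.2).a x x'
        else (1 : Matrix (Fin dA) (Fin dA) ℂ) x x') =
        (if p.1 = v then (A p.2).effect (τ p.2).s (τ p.2).a else 1) x x' := fun x x' => by
      split_ifs <;> rfl
    simp only [hite]
    by_cases h : p.1 ∈ S
    · simp only [slot, h, dif_pos, reduced]
    · simp only [slot, h, dif_neg, not_false_eq_true, reduced, Matrix.trace, Matrix.diag,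
        Finset.mul_sum]
      rw [Finset.sum_comm]
      exact Finset.sum_congr rfl fun x _ => Finset.sum_comm
  simp only [hops, hslot, Finset.prod_univ_sum, Fintype.piFinset_univ]
  exact Finset.sum_congr rfl fun x _ => Finset.sum_congr rfl fun x' _ =>
    Finset.prod_mul_distrib.symm

lemma Strategy.transcriptProb_eq (σ : Strategy S N dB) (v : U) (A : Fin N → Measurement dA)
    (K : Fin N → Matrix (Fin dB) (Fin dB) ℂ) (τ : Fin N → Round) :
    σ.transcriptProb ρ v A τ = (1 / 4) ^ N *
      (σ.recordEffect (fun i => (τ i).t) (List.ofFn τ) *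
        tensor S (recordOps v (fun i x => reduced (ρ v i) ((A i).effect x.s x.a)) K
          (fun p => reduced (ρ p.1 p.2) 1) (List.ofFn τ))).trace.re := by
  rw [transcriptProb, σ.trace_evolve, trace_one_kronecker_conj, trace_kronecker_mul,
    reduced_sharedState v A τ K, recordEffect]

lemma Strategy.transcriptProb_nonneg (σ : Strategy S N dB) (hρ : ∀ u i, (ρ u i).PosSemidef) (v : U)
    (A : Fin N → Measurement dA) (τ : Fin N → Round) : 0 ≤ σ.transcriptProb ρ v A τ := by
  rw [σ.transcriptProb_eq v A 0]
  refine mul_nonneg (by positivity) (Complex.le_def.mp (trace_mul_nonneg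
    (σ.recordEffect_posSemidef _ _) (tensor_posSemidef (recordOps_posOn (fun i x => ?_)
      (fun i => ?_) (fun p => ?_) _)))).1
  · exact (reduced_posSemidef (hρ v i) ((A i).posSemidef _ _)).posOn _
  · exact Matrix.PosSemidef.zero.posOn _
  · exact (reduced_posSemidef (hρ _ _) Matrix.PosSemidef.one).posOn _

/-- The coalition knows all its questions in advance, so each list `q` is bounded separately, by the
product of the traces of `K i (q i)`. Summing these products over `q` gives a product of one-round
sums. -/
lemma Strategy.sum_transcriptProb_mul_le (σ : Strategy S N dB) (hρ : ∀ u i, IsDensity (ρ u i))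
    (v : U) (A : Fin N → Measurement dA) {p r : ℝ} (hr : 1 ≤ r)
    (hp : v ∈ S → ∀ i, ∀ B : Measurement dB, chshWinProb (ρ v i) (A i) B ≤ p)
    (hp' : v ∉ S → ∀ i f, chshWinProb (ρ v i) (A i) (Measurement.deterministic dB f) ≤ p) :
    ∑ τ, σ.transcriptProb ρ v A τ *
      ((List.ofFn τ).map fun x => if Wins x.s x.t x.a x.b then r else 1).prod ≤
      (1 + (r - 1) * p) ^ N := by
  choose K hK hKR hKp using fun i => exists_dual (v ∈ S) (hρ v i) (A i) hr (fun h => hp h i)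
    (fun h => hp' h i)
  let w : Round → ℝ := fun x => if Wins x.s x.t x.a x.b then r else 1
  have hw : ∀ x, 0 ≤ w x := fun x => by
    simp only [w]
    split_ifs <;> linarith
  -- The weight of one round: the probability of its questions, the reward, and an indicator that
  -- removes all transcripts whose questions differ from `q`.
  let c : (Fin N → Bool) → Fin N → Round → ℝ := fun q i x => 1 / 4 * if x.t = q i then w x else 0
  have hc : ∀ q i x, 0 ≤ c q i x := fun q i x => by
    have := hw x
    simp only [c]
    split_ifs <;> linarith
  let R : (Fin N → Bool) → Fin N → Round → Matrix (Fin dB) (Fin dB) ℂ := fun q i x =>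
    (c q i x : ℂ) • reduced (ρ v i) ((A i).effect x.s x.a)
  let F : U × Fin N → Matrix (Fin dB) (Fin dB) ℂ := fun p => reduced (ρ p.1 p.2) 1
  have hFtr : ∀ p, (F p).trace = 1 := fun p => by
    simp only [F, trace_reduced_one, (hρ _ _).2]
  -- a transcript only contributes to the term of its own questions
  have hterm : ∀ q τ, (σ.recordEffect q (List.ofFn τ) *
      tensor S (recordOps v (R q) (fun i => K i (q i)) F (List.ofFn τ))).trace.re =
      if q = fun i => (τ i).t then σ.transcriptProb ρ v A τ * ((List.ofFn τ).map w).prod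
        else 0 := fun q τ => by
    have h1 : recordOps v (R q) (fun i => K i (q i)) F (List.ofFn τ) = fun p =>
        (if p.1 = v then (c q p.2 (τ p.2) : ℂ) else 1) • recordOps v
          (fun i x => reduced (ρ v i) ((A i).effect x.s x.a)) 0 F (List.ofFn τ) p := by
      ext1 p
      simp only [recordOps]
      split_ifs with h
      · simp [R]
      · simp
    have h2 : ∏ p : U × Fin N, (if p.1 = v then (c q p.2 (τ p.2) : ℂ) else 1) =
        ((∏ i, c q i (τ i) : ℝ) : ℂ) := by
      rw [Fintype.prod_prod_type, Finset.prod_eq_single v]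
      · simp
      · intro u _ hu
        simp [hu]
      · simp
    rw [h1, tensor_smul, h2, Matrix.mul_smul, Matrix.trace_smul, smul_eq_mul, Complex.re_ofReal_mul]
    split_ifs with hq
    · rw [σ.transcriptProb_eq v A 0, hq, List.map_ofFn, List.prod_ofFn]
      simp only [c, if_true, Finset.prod_mul_distrib, Finset.prod_const, Finset.card_univ,
        Fintype.card_fin, Function.comp, F]
      ring
    · obtain ⟨i, hi⟩ := Function.ne_iff.mp hq
      rw [Finset.prod_eq_zero (Finset.mem_univ i), zero_mul]
      simp [c, Ne.symm hi]
  have hsum : ∀ q : Fin N → Bool, ∑ τ, (σ.recordEffect q (List.ofFn τ) *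
      tensor S (recordOps v (R q) (fun i => K i (q i)) F (List.ofFn τ))).trace.re ≤
      ∏ i, (K i (q i)).trace.re := fun q => by
    have h := σ.sum_trace_recordEffect_mul_le q (v := v) (r := R q) (K := fun i => K i (q i))
      (F := F) (fun i x => (smul_reduced_posSemidef (hρ v i).1 (A i) (hc q i x) _ _).posOn _)
      (fun i => hK i _)
      (fun p => (reduced_posSemidef (hρ _ _).1 Matrix.PosSemidef.one).posOn _)
      (fun i b => ?_) N [] (by simp)
    · refine h.trans_eq ?_
      rw [σ.recordEffect_nil, Matrix.one_mul, trace_tensor_recordOps_nil hFtr]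
      have : ∀ i, (K i (q i)).trace = ((K i (q i)).trace.re : ℂ) := fun i =>
        Complex.ext rfl (Complex.le_def.mp (hK i (q i)).trace_nonneg).2.symm
      rw [Finset.prod_congr rfl fun i _ => this i, ← Complex.ofReal_prod, Complex.ofReal_re]
    -- The indicator leaves only `t = q i`, and the summed rewards are then `answerOp` for this
    -- question.
    · convert hKR i (q i) b using 2
      rw [answerOp]
      refine Finset.sum_congr rfl fun s _ => ?_
      rw [Finset.sum_eq_single (q i)]
      · simp [R, c, w]
      · intro t _ ht
        simp [R, c, ht]
      · simp
  calc _ = ∑ τ, ∑ q : Fin N → Bool, (σ.recordEffect q (List.ofFn τ) *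
        tensor S (recordOps v (R q) (fun i => K i (q i)) F (List.ofFn τ))).trace.re := by
        refine Finset.sum_congr rfl fun τ _ => ?_
        rw [Finset.sum_congr rfl fun q _ => hterm q τ, Finset.sum_ite_eq',
          if_pos (Finset.mem_univ _)]
    _ ≤ ∑ q : Fin N → Bool, ∏ i, (K i (q i)).trace.re := by
        rw [Finset.sum_comm]
        exact Finset.sum_le_sum fun q _ => hsum q
    _ = ∏ i, ∑ t, (K i t).trace.re := by
        rw [Finset.prod_univ_sum, Fintype.piFinset_univ]
    _ ≤ ∏ _i : Fin N, (1 + (r - 1) * p) :=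
        Finset.prod_le_prod (fun i _ => Finset.sum_nonneg fun t _ =>
          (Complex.le_def.mp (hK i t).trace_nonneg).1) fun i _ => hKp i
    _ = _ := by simp

theorem Strategy.acceptProb_transcriptProb_le (σ : Strategy S N dB)
    (hρ : ∀ u i, IsDensity (ρ u i)) (v : U) (A : Fin N → Measurement dA) {c p x : ℝ} (hc : 0 < c)
    (hx0 : 0 ≤ x) (hx1 : x ≤ 1) (hpx : p ≤ (1 - c) * omega x)
    (hp : v ∈ S → ∀ i, ∀ B : Measurement dB, chshWinProb (ρ v i) (A i) B ≤ p)
    (hp' : v ∉ S → ∀ i f, chshWinProb (ρ v i) (A i) (Measurement.deterministic dB f) ≤ p) :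
    acceptProb c x (σ.transcriptProb ρ v A) ≤
      Real.exp (-2 * ((1 - c) * omega x - p) ^ 2 * N) := by
  refine acceptProb_le_exp hc _ (fun τ => σ.transcriptProb_nonneg (fun u i => (hρ u i).1) v A τ)
    (fun hN => ?_) (omega_le_one hx0 hx1) hpx fun l hl => ?_
  · refine (chshWinProb_nonneg (hρ v ⟨0, hN⟩).1 (A ⟨0, hN⟩)
      (Measurement.deterministic dB fun _ => false)).trans ?_
    by_cases hv : v ∈ S
    exacts [hp hv _ _, hp' hv _ _]
  · simp_rw [exp_mul_wins]
    exact σ.sum_transcriptProb_mul_le hρ v A (Real.one_le_exp hl) hp hp'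

/-- Answers that do not depend on the User's half win with probability at most `3 / 4`. -/
lemma chshWinProb_deterministic_le {ρ : Matrix (Fin dA × Fin dB) (Fin dA × Fin dB) ℂ}
    (hρ : IsDensity ρ) (A : Measurement dA) (f : Bool → Bool) :
    chshWinProb ρ A (Measurement.deterministic dB f) ≤ 3 / 4 := by
  have h0 := fun s t a b => bornProb_nonneg hρ.1 A (Measurement.deterministic dB f) s t a b
  have h1 := sum_bornProb hρ.2 A (Measurement.deterministic dB f)
  have h2 : ∀ s t a b, b = f t → bornProb ρ A (Measurement.deterministic dB f) s t a b =
      (ρ * (A.effect s a ⊗ₖ (1 : Matrix (Fin dB) (Fin dB) ℂ))).trace.re := fun s t a b hb => by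
    simp [bornProb, Measurement.deterministic, hb]
  have h3 : ∀ s t a b, b ≠ f t → bornProb ρ A (Measurement.deterministic dB f) s t a b = 0 :=
    fun s t a b hb => by
      simp [bornProb, Measurement.deterministic, hb]
  -- A deterministic User leaves only the Authorizer's marginals `g`; for each of the four answer
  -- functions the bound is linear in them.
  set g : Bool → Bool → ℝ := fun s a =>
    (ρ * (A.effect s a ⊗ₖ (1 : Matrix (Fin dB) (Fin dB) ℂ))).trace.re
  have hb : ∀ s t a b, bornProb ρ A (Measurement.deterministic dB f) s t a b =
      if b = f t then g s a else 0 := fun s t a b => by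
    split_ifs with h
    exacts [h2 s t a b h, h3 s t a b h]
  simp only [hb] at h0 h1
  have hg0 : ∀ s a, 0 ≤ g s a := fun s a => by simpa using h0 s false a (f false)
  have hg1 : ∀ s, g s true + g s false = 1 := fun s => by
    simpa using h1 s false
  simp only [chshWinProb, hb, Fintype.sum_bool, Wins]
  have a1 := hg0 true true
  have a2 := hg0 true false
  have a3 := hg0 false true
  have a4 := hg0 false false
  have a5 := hg1 true
  have a6 := hg1 false
  generalize f true = u
  generalize f false = v
  cases u <;> cases v <;> simp <;> linarith

end Coalition

/-! ### The concurrence of pure states -/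

lemma trace_pureState {n : Type*} [Fintype n] {ψ : n → ℂ} (hψ : ∑ x, ‖ψ x‖ ^ 2 = 1) :
    (pureState ψ).trace = 1 := by
  rw [pureState, Matrix.trace_vecMulVec, dotProduct]
  simp only [Pi.star_apply, RCLike.star_def, Complex.mul_conj, Complex.normSq_eq_norm_sq]
  exact_mod_cast hψ

lemma isDensity_pureState {n : Type*} [Fintype n] {ψ : n → ℂ} (hψ : ∑ x, ‖ψ x‖ ^ 2 = 1) :
    IsDensity (pureState ψ) :=
  ⟨Matrix.posSemidef_vecMulVec_self_star ψ, trace_pureState hψ⟩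

/-- The squared concurrence of a pure state. -/
def concSq (ψ : Fin 2 × Fin 2 → ℂ) : ℝ :=
  4 * Complex.normSq (ψ (0, 0) * ψ (1, 1) - ψ (0, 1) * ψ (1, 0))

lemma concSq_nonneg (ψ : Fin 2 × Fin 2 → ℂ) : 0 ≤ concSq ψ :=
  mul_nonneg (by norm_num) (Complex.normSq_nonneg _)

/-- For a pure state the product has rank at most one, so its trace `ψ ⬝ᵥ φ` is the only eigenvalue
that can be nonzero. -/
lemma wootters_product (ψ : Fin 2 × Fin 2 → ℂ) : ∃ φ : Fin 2 × Fin 2 → ℂ,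
    pureState ψ * (pauliY ⊗ₖ pauliY) * (pureState ψ).map star * (pauliY ⊗ₖ pauliY) =
      Matrix.vecMulVec ψ φ ∧ ψ ⬝ᵥ φ = (concSq ψ : ℂ) := by
  have hmap : (pureState ψ).map star = Matrix.vecMulVec (star ψ) ψ := by
    ext i j
    simp [pureState, Matrix.vecMulVec_apply]
  refine ⟨((star ψ ᵥ* (pauliY ⊗ₖ pauliY)) ⬝ᵥ star ψ) • (ψ ᵥ* (pauliY ⊗ₖ pauliY)), ?_, ?_⟩
  · rw [hmap, pureState, Matrix.vecMulVec_mul, Matrix.vecMulVec_mul_vecMulVec,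
      Matrix.vecMulVec_mul, Matrix.smul_vecMul]
  · rw [dotProduct_smul, concSq]
    simp only [dotProduct, Matrix.vecMul, Fintype.sum_prod_type, Fin.sum_univ_two,
      Matrix.kronecker_apply, pauliY, Matrix.of_apply, Matrix.cons_val', Matrix.cons_val_zero,
      Matrix.cons_val_one, Matrix.cons_val_fin_one, Pi.star_apply, smul_eq_mul, RCLike.star_def]
    push_cast
    rw [← Complex.mul_conj]
    simp only [map_sub, map_mul]
    ring_nf
    simp only [Complex.I_pow_four]
    ring

lemma woottersValues_pureState (ψ : Fin 2 × Fin 2 → ℂ) :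
    woottersValues (pureState ψ) = [√(concSq ψ), 0, 0, 0] := by
  obtain ⟨φ, h1, h2⟩ := wootters_product ψ
  have hp : (Matrix.vecMulVec ψ φ).charpoly =
      Polynomial.X ^ 3 * (Polynomial.X - Polynomial.C (concSq ψ : ℂ)) := by
    rw [Matrix.charpoly_vecMulVec, h2, Polynomial.smul_eq_C_mul]
    simp only [Fintype.card_prod, Fintype.card_fin]
    ring
  have hr : (Matrix.vecMulVec ψ φ).charpoly.roots = {(concSq ψ : ℂ), 0, 0, 0} := by
    rw [hp, Polynomial.roots_mul (mul_ne_zero (pow_ne_zero _ Polynomial.X_ne_zero)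
      (Polynomial.X_sub_C_ne_zero _)), Polynomial.roots_X_pow, Polynomial.roots_X_sub_C, add_comm]
    rfl
  rw [woottersValues, h1, hr]
  have h0 := Real.sqrt_nonneg (concSq ψ)
  simp [Multiset.sort_cons, h0]

lemma concurrence_pureState (ψ : Fin 2 × Fin 2 → ℂ) :
    concurrence (pureState ψ) = √(concSq ψ) := by
  rw [concurrence, woottersValues_pureState]
  simp [Real.sqrt_nonneg]

lemma omega_concurrence_pureState (ψ : Fin 2 × Fin 2 → ℂ) :
    omega (concurrence (pureState ψ)) = 1 / 2 + 1 / 4 * √(1 + concSq ψ) := by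
  rw [omega, concurrence_pureState, Real.sq_sqrt (concSq_nonneg ψ)]

/-! ### Correlations of Pauli observables -/

/-- The expectation of the observable `X ⊗ Y` in the pure state `ψ`. -/
def corr (ψ : Fin 2 × Fin 2 → ℂ) (X Y : Matrix (Fin 2) (Fin 2) ℂ) : ℝ :=
  (pureState ψ * (X ⊗ₖ Y)).trace.re

variable (ψ : Fin 2 × Fin 2 → ℂ)

lemma corr_add_left (X X' Y : Matrix (Fin 2) (Fin 2) ℂ) :
    corr ψ (X + X') Y = corr ψ X Y + corr ψ X' Y := by
  simp [corr, Matrix.add_kronecker, Matrix.mul_add]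

lemma corr_add_right (X Y Y' : Matrix (Fin 2) (Fin 2) ℂ) :
    corr ψ X (Y + Y') = corr ψ X Y + corr ψ X Y' := by
  simp [corr, Matrix.kronecker_add, Matrix.mul_add]

lemma corr_smul_left (r : ℝ) (X Y : Matrix (Fin 2) (Fin 2) ℂ) :
    corr ψ ((r : ℂ) • X) Y = r * corr ψ X Y := by
  simp [corr, Matrix.smul_kronecker]

lemma corr_smul_right (r : ℝ) (X Y : Matrix (Fin 2) (Fin 2) ℂ) :
    corr ψ X ((r : ℂ) • Y) = r * corr ψ X Y := by
  simp [corr, Matrix.kronecker_smul]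

lemma corr_neg_left (X Y : Matrix (Fin 2) (Fin 2) ℂ) : corr ψ (-X) Y = -corr ψ X Y := by
  simpa using corr_smul_left ψ (-1) X Y

lemma corr_neg_right (X Y : Matrix (Fin 2) (Fin 2) ℂ) : corr ψ X (-Y) = -corr ψ X Y := by
  simpa using corr_smul_right ψ (-1) X Y

lemma corr_sub_left (X X' Y : Matrix (Fin 2) (Fin 2) ℂ) :
    corr ψ (X - X') Y = corr ψ X Y - corr ψ X' Y := by
  rw [sub_eq_add_neg, corr_add_left, corr_neg_left, sub_eq_add_neg]

lemma corr_sub_right (X Y Y' : Matrix (Fin 2) (Fin 2) ℂ) :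
    corr ψ X (Y - Y') = corr ψ X Y - corr ψ X Y' := by
  rw [sub_eq_add_neg, corr_add_right, corr_neg_right, sub_eq_add_neg]

/-- The observable `u · σ`. -/
def pauli (u : Fin 3 → ℝ) : Matrix (Fin 2) (Fin 2) ℂ :=
  !![(u 2 : ℂ), u 0 - u 1 * Complex.I; u 0 + u 1 * Complex.I, -u 2]

lemma pauli_add (u v : Fin 3 → ℝ) : pauli (u + v) = pauli u + pauli v := by
  ext i j
  fin_cases i <;> fin_cases j <;> simp [pauli] <;> ring

lemma pauli_smul (r : ℝ) (u : Fin 3 → ℝ) : pauli (r • u) = (r : ℂ) • pauli u := by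
  ext i j
  fin_cases i <;> fin_cases j <;> simp [pauli] <;> ring

lemma pauli_sub (u v : Fin 3 → ℝ) : pauli (u - v) = pauli u - pauli v := by
  ext i j
  fin_cases i <;> fin_cases j <;> simp [pauli] <;> ring

lemma pauli_eq_sum (u : Fin 3 → ℝ) :
    pauli u = (u 0 : ℂ) • pauli ![1, 0, 0] + (u 1 : ℂ) • pauli ![0, 1, 0] +
      (u 2 : ℂ) • pauli ![0, 0, 1] := by
  ext i j
  fin_cases i <;> fin_cases j <;> simp [pauli]
  ring

/-- The correlation matrix applied to the Bloch vector `v` of the second observable. -/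
def corrVec (v : Fin 3 → ℝ) : Fin 3 → ℝ :=
  ![corr ψ (pauli ![1, 0, 0]) (pauli v), corr ψ (pauli ![0, 1, 0]) (pauli v),
    corr ψ (pauli ![0, 0, 1]) (pauli v)]

/-- The Bloch vector of the second qubit. -/
def blochVec : Fin 3 → ℝ :=
  ![corr ψ 1 (pauli ![1, 0, 0]), corr ψ 1 (pauli ![0, 1, 0]), corr ψ 1 (pauli ![0, 0, 1])]

lemma corr_pauli (u v : Fin 3 → ℝ) : corr ψ (pauli u) (pauli v) = u ⬝ᵥ corrVec ψ v := by
  rw [pauli_eq_sum u]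
  simp only [corr_add_left, corr_smul_left]
  simp [corrVec, dotProduct, Fin.sum_univ_three]

lemma corr_apply (X Y : Matrix (Fin 2) (Fin 2) ℂ) :
    corr ψ X Y = (∑ i, ∑ j, ∑ k, ∑ l, star (ψ (i, j)) * X i k * Y j l * ψ (k, l)).re := by
  rw [corr, pureState, Matrix.vecMulVec_mul, Matrix.trace_vecMulVec, dotProduct_comm]
  simp only [dotProduct, Matrix.vecMul, Fintype.sum_prod_type, Fin.sum_univ_two,
    Matrix.kronecker_apply, Pi.star_apply]
  congr 1
  ring

/-- A polynomial identity that says `TᵀT = k 1 + s sᵀ` for the correlation matrix `T`, the squared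
concurrence `k` and the Bloch vector `s`. It replaces the Schmidt decomposition. -/
lemma corrVec_dotProduct_self (v : Fin 3 → ℝ) : corrVec ψ v ⬝ᵥ corrVec ψ v =
    concSq ψ * (v ⬝ᵥ v) + (blochVec ψ ⬝ᵥ v) ^ 2 := by
  simp [corrVec, blochVec, corr_apply, Fin.sum_univ_two, dotProduct, Fin.sum_univ_three, pauli,
    concSq, Complex.normSq_apply]
  ring

/-- Both `1 - |s|²` and `k` are four times the determinant of the reduced state of the second qubit.
-/
lemma blochVec_dotProduct_self (hψ : ∑ x, ‖ψ x‖ ^ 2 = 1) :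
    blochVec ψ ⬝ᵥ blochVec ψ = 1 - concSq ψ := by
  have h : (blochVec ψ ⬝ᵥ blochVec ψ) = (∑ x, ‖ψ x‖ ^ 2) ^ 2 - concSq ψ := by
    simp [blochVec, corr_apply, Fin.sum_univ_two, dotProduct, Fin.sum_univ_three, pauli,
      concSq, Complex.normSq_apply, Fintype.sum_prod_type, Complex.sq_norm]
    ring
  rw [h, hψ, one_pow]

/-! ### The CHSH game with a pure two-qubit state -/

/-- An observable with spectrum in `[-1, 1]`. -/
def IsObservable (O : Matrix (Fin 2) (Fin 2) ℂ) : Prop :=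
  (1 + O).PosSemidef ∧ (1 - O).PosSemidef

/-- The observable of a two-outcome measurement. -/
def Measurement.observable (A : Measurement 2) (q : Bool) : Matrix (Fin 2) (Fin 2) ℂ :=
  A.effect q false - A.effect q true

lemma Measurement.isObservable (A : Measurement 2) (q : Bool) : IsObservable (A.observable q) := by
  have h1 : 1 + A.observable q = A.effect q false + A.effect q false := by
    rw [observable, ← A.complete q]
    abel
  have h2 : 1 - A.observable q = A.effect q true + A.effect q true := by
    rw [observable, ← A.complete q]
    abel
  refine ⟨?_, ?_⟩
  · rw [h1]
    exact (A.posSemidef q false).add (A.posSemidef q false)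
  · rw [h2]
    exact (A.posSemidef q true).add (A.posSemidef q true)

lemma pauli_mul_self (u : Fin 3 → ℝ) : pauli u * pauli u = ((u ⬝ᵥ u : ℝ) : ℂ) • 1 := by
  ext i j
  fin_cases i <;> fin_cases j <;>
    simp [pauli, dotProduct, Fin.sum_univ_three] <;> ring_nf <;> simp

lemma pauli_isHermitian (u : Fin 3 → ℝ) : (pauli u).IsHermitian := by
  ext i j
  fin_cases i <;> fin_cases j <;> simp [pauli, Matrix.conjTranspose_apply] <;> ring

lemma pauli_neg (u : Fin 3 → ℝ) : pauli (-u) = -pauli u := by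
  simpa using pauli_smul (-1) u

lemma one_add_pauli_posSemidef {u : Fin 3 → ℝ} (hu : u ⬝ᵥ u = 1) : (1 + pauli u).PosSemidef := by
  have h : (1 + pauli u)ᴴ * (1 + pauli u) = (2 : ℂ) • (1 + pauli u) := by
    rw [Matrix.conjTranspose_add, Matrix.conjTranspose_one, (pauli_isHermitian u).eq,
      Matrix.add_mul, Matrix.one_mul, Matrix.mul_add, Matrix.mul_one, pauli_mul_self, hu]
    rw [two_smul, Complex.ofReal_one, one_smul]
    abel
  have h2 : 1 + pauli u = (1 / 2 : ℂ) • ((1 + pauli u)ᴴ * (1 + pauli u)) := by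
    rw [h, smul_smul]
    norm_num
  rw [h2]
  exact (Matrix.posSemidef_conjTranspose_mul_self _).smul (by norm_num [Complex.le_def])

lemma one_sub_pauli_posSemidef {u : Fin 3 → ℝ} (hu : u ⬝ᵥ u = 1) : (1 - pauli u).PosSemidef := by
  have := one_add_pauli_posSemidef (u := -u) (by simpa using hu)
  rwa [pauli_neg, ← sub_eq_add_neg] at this

lemma isObservable_pauli {u : Fin 3 → ℝ} (hu : u ⬝ᵥ u = 1) : IsObservable (pauli u) :=
  ⟨one_add_pauli_posSemidef hu, one_sub_pauli_posSemidef hu⟩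

/-- The measurements of the observables `u q · σ`. -/
def Measurement.pauli (u : Bool → Fin 3 → ℝ) (hu : ∀ q, u q ⬝ᵥ u q = 1) : Measurement 2 where
  effect q a := (1 / 2 : ℂ) • if a then 1 - QAuth.pauli (u q) else 1 + QAuth.pauli (u q)
  posSemidef q a := by
    refine Matrix.PosSemidef.smul ?_ (by norm_num [Complex.le_def])
    split_ifs
    exacts [one_sub_pauli_posSemidef (hu q), one_add_pauli_posSemidef (hu q)]
  complete q := by
    rw [← smul_add]
    simp only [Bool.false_eq_true, if_false, if_true, add_add_sub_cancel]
    rw [← two_smul ℂ (1 : Matrix (Fin 2) (Fin 2) ℂ), smul_smul]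
    norm_num

lemma Measurement.observable_pauli (u : Bool → Fin 3 → ℝ) (hu : ∀ q, u q ⬝ᵥ u q = 1) (q : Bool) :
    (Measurement.pauli u hu).observable q = QAuth.pauli (u q) := by
  rw [observable, Measurement.pauli]
  simp only [Bool.false_eq_true, if_false, if_true]
  rw [← smul_sub, add_sub_sub_cancel, ← two_smul ℂ, smul_smul]
  norm_num

lemma exists_unit_dotProduct_eq (w : Fin 3 → ℝ) : ∃ u : Fin 3 → ℝ, u ⬝ᵥ u = 1 ∧
    w = √(w ⬝ᵥ w) • u := by
  have h0 : 0 ≤ w ⬝ᵥ w := Finset.sum_nonneg fun i _ => mul_self_nonneg _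
  by_cases h : w ⬝ᵥ w = 0
  · refine ⟨![1, 0, 0], by simp [dotProduct, Fin.sum_univ_three], ?_⟩
    rw [dotProduct_self_eq_zero] at h
    simp [h]
  · have hs : √(w ⬝ᵥ w) ≠ 0 := (Real.sqrt_ne_zero h0).mpr h
    refine ⟨(√(w ⬝ᵥ w))⁻¹ • w, ?_, by rw [smul_smul, mul_inv_cancel₀ hs, one_smul]⟩
    rw [smul_dotProduct, dotProduct_smul, smul_eq_mul, smul_eq_mul]
    nth_rw 3 [← Real.mul_self_sqrt h0]
    field_simp

/-- Observables are mixtures of `1`, `-1` and Pauli observables. -/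
lemma IsObservable.exists_mixture {O : Matrix (Fin 2) (Fin 2) ℂ} (hO : IsObservable O) :
    ∃ (x y z : ℝ) (u : Fin 3 → ℝ), 0 ≤ x ∧ 0 ≤ y ∧ 0 ≤ z ∧ x + y + z = 1 ∧ u ⬝ᵥ u = 1 ∧
      O = (x : ℂ) • 1 + (y : ℂ) • (-1) + (z : ℂ) • pauli u := by
  obtain ⟨hp, hm⟩ := hO
  have hH : O.IsHermitian := by
    have := hp.1.sub (Matrix.isHermitian_one (n := Fin 2) (α := ℂ))
    rwa [add_sub_cancel_left] at this
  set α : ℝ := ((O 0 0).re + (O 1 1).re) / 2 with hα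
  set w : Fin 3 → ℝ := ![(O 1 0).re, (O 1 0).im, ((O 0 0).re - (O 1 1).re) / 2] with hw
  have h00 : (O 0 0).im = 0 := by
    have := congrArg Complex.im (hH.apply 0 0)
    simp at this
    linarith
  have h11 : (O 1 1).im = 0 := by
    have := congrArg Complex.im (hH.apply 1 1)
    simp at this
    linarith
  have h01 : O 0 1 = star (O 1 0) := (hH.apply 0 1).symm
  have hdec : O = (α : ℂ) • 1 + pauli w := by
    ext i j
    fin_cases i <;> fin_cases j <;> apply Complex.ext <;>
      simp [pauli, hα, hw, h00, h11, h01] <;> ring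
  -- The determinant of `1 + s O` is `(1 + s α)² - |w|²`, and the trace fixes the sign of `1 + s α`.
  have hdet : ∀ s : ℝ, s ^ 2 = 1 → (1 + (s : ℂ) • O).PosSemidef →
      √(w ⬝ᵥ w) ≤ 1 + s * α := fun s hs hP => by
    have d := (Complex.le_def.mp hP.det_nonneg).1
    have t := (Complex.le_def.mp hP.trace_nonneg).1
    rw [hdec] at d t
    simp [Matrix.det_fin_two, Matrix.trace, Fin.sum_univ_two, pauli] at d t
    refine Real.sqrt_le_iff.mpr ⟨by linarith, ?_⟩
    simp only [dotProduct, Fin.sum_univ_three]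
    have e : s ^ 2 * (w 0 * w 0 + w 1 * w 1 + w 2 * w 2) =
      w 0 * w 0 + w 1 * w 1 + w 2 * w 2 := by rw [hs, one_mul]
    nlinarith
  have h1 := hdet 1 (by norm_num) (by simpa using hp)
  have h2 := hdet (-1) (by norm_num) (by simpa [sub_eq_add_neg] using hm)
  obtain ⟨u, hu, hwu⟩ := exists_unit_dotProduct_eq w
  set n := √(w ⬝ᵥ w)
  -- The Pauli observable gets the weight `|w|`; the weights of `1` and `-1` differ by `α` and fill
  -- up the rest.
  refine ⟨(1 - n + α) / 2, (1 - n - α) / 2, n, u, by linarith, by linarith, Real.sqrt_nonneg _,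
    by ring, hu, ?_⟩
  rw [hdec, hwu, pauli_smul, smul_neg, ← sub_eq_add_neg, ← sub_smul, ← Complex.ofReal_sub]
  congr 4
  ring

/-- An affine functional that is bounded at `1`, `-1` and at all Pauli observables is bounded by
the same number at every observable. -/
lemma IsObservable.le_of_extreme {O : Matrix (Fin 2) (Fin 2) ℂ} (hO : IsObservable O)
    {f : Matrix (Fin 2) (Fin 2) ℂ → ℝ} {k b : ℝ} (hadd : ∀ X Y, f (X + Y) = f X + f Y)
    (hsmul : ∀ (r : ℝ) X, f ((r : ℂ) • X) = r * f X) (h1 : f 1 + k ≤ b) (h2 : f (-1) + k ≤ b)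
    (h3 : ∀ u : Fin 3 → ℝ, u ⬝ᵥ u = 1 → f (pauli u) + k ≤ b) : f O + k ≤ b := by
  obtain ⟨x, y, z, u, hx, hy, hz, hxyz, hu, rfl⟩ := hO.exists_mixture
  rw [hadd, hadd, hsmul, hsmul, hsmul]
  have h3 := h3 u hu
  calc _ = x * (f 1 + k) + y * (f (-1) + k) + z * (f (pauli u) + k) := by
        linear_combination (-k) * hxyz
    _ ≤ x * b + y * b + z * b := by gcongr
    _ = b := by rw [← add_mul, ← add_mul, hxyz, one_mul]

lemma corr_nonneg {X Y : Matrix (Fin 2) (Fin 2) ℂ} (hX : X.PosSemidef) (hY : Y.PosSemidef) :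
    0 ≤ corr ψ X Y :=
  (Complex.le_def.mp <| trace_mul_nonneg (Matrix.posSemidef_vecMulVec_self_star ψ)
    (hX.kronecker hY)).1

/-- The CHSH expression. -/
def chshValue (A₀ A₁ B₀ B₁ : Matrix (Fin 2) (Fin 2) ℂ) : ℝ :=
  corr ψ A₀ B₀ + corr ψ A₀ B₁ + corr ψ A₁ B₀ - corr ψ A₁ B₁

variable {ψ}

lemma corr_one_one (hψ : ∑ x, ‖ψ x‖ ^ 2 = 1) : corr ψ 1 1 = 1 := by
  rw [corr, Matrix.one_kronecker_one, Matrix.mul_one, trace_pureState hψ, Complex.one_re]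

/-- A question pair is won with probability `(1 ± ⟨A ⊗ B⟩) / 2`, with the minus sign only for `s = t
= 1`. -/
lemma chshWinProb_eq (hψ : ∑ x, ‖ψ x‖ ^ 2 = 1) (A B : Measurement 2) :
    chshWinProb (pureState ψ) A B = 1 / 2 + 1 / 8 * chshValue ψ (A.observable false)
      (A.observable true) (B.observable false) (B.observable true) := by
  have h := fun s t => sum_bornProb (trace_pureState hψ) A B s t
  have hb : ∀ s t a b, bornProb (pureState ψ) A B s t a b =
      corr ψ (A.effect s a) (B.effect t b) := fun _ _ _ _ => rfl
  have h1 := h false false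
  have h2 := h false true
  have h3 := h true false
  have h4 := h true true
  simp only [hb, Fintype.sum_bool] at h1 h2 h3 h4
  simp [chshWinProb, hb, Wins, chshValue, Measurement.observable, corr_sub_left, corr_sub_right]
  linarith

/-- The classical bound, if one of the observables is `1` or `-1`. -/
lemma chshValue_le_two (hψ : ∑ x, ‖ψ x‖ ^ 2 = 1) {X Y Z : Matrix (Fin 2) (Fin 2) ℂ}
    (hX : IsObservable X) (hY : IsObservable Y) (hZ : IsObservable Z) :
    (chshValue ψ 1 X Y Z ≤ 2 ∧ chshValue ψ (-1) X Y Z ≤ 2) ∧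
    (chshValue ψ X 1 Y Z ≤ 2 ∧ chshValue ψ X (-1) Y Z ≤ 2) ∧
    (chshValue ψ X Y 1 Z ≤ 2 ∧ chshValue ψ X Y (-1) Z ≤ 2) ∧
    (chshValue ψ X Y Z 1 ≤ 2 ∧ chshValue ψ X Y Z (-1) ≤ 2) := by
  have h1 := corr_one_one hψ
  -- Positivity of `⟨(1 ± P) ⊗ (1 ± Q)⟩` for the pairs among `X`, `Y`, `Z` implies all eight bounds
  -- linearly.
  have p := fun (P Q : Matrix (Fin 2) (Fin 2) ℂ) (hP : IsObservable P) (hQ : IsObservable Q) =>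
    And.intro (And.intro (corr_nonneg ψ hP.1 hQ.1) (corr_nonneg ψ hP.1 hQ.2))
      (And.intro (corr_nonneg ψ hP.2 hQ.1) (corr_nonneg ψ hP.2 hQ.2))
  have pXY := p X Y hX hY
  have pXZ := p X Z hX hZ
  have pYZ := p Y Z hY hZ
  simp only [corr_add_left, corr_add_right, corr_sub_left, corr_sub_right, h1] at pXY pXZ pYZ
  obtain ⟨⟨_, _⟩, _, _⟩ := pXY
  obtain ⟨⟨_, _⟩, _, _⟩ := pXZ
  obtain ⟨⟨_, _⟩, _, _⟩ := pYZ
  simp only [chshValue, corr_neg_left, corr_neg_right]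
  refine ⟨⟨?_, ?_⟩, ⟨?_, ?_⟩, ⟨?_, ?_⟩, ?_, ?_⟩ <;> linarith

lemma sq_dotProduct_le (u w : Fin 3 → ℝ) : (u ⬝ᵥ w) ^ 2 ≤ (u ⬝ᵥ u) * (w ⬝ᵥ w) := by
  have := Finset.sum_mul_sq_le_sq_mul_sq Finset.univ u w
  simpa only [dotProduct, ← sq] using this

/-- Bessel's inequality for two orthogonal vectors. -/
lemma bessel_dotProduct (s u w : Fin 3 → ℝ) (huw : u ⬝ᵥ w = 0) (hu : 0 < u ⬝ᵥ u)
    (hw : 0 < w ⬝ᵥ w) : (s ⬝ᵥ u) ^ 2 * (w ⬝ᵥ w) + (s ⬝ᵥ w) ^ 2 * (u ⬝ᵥ u) ≤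
      (s ⬝ᵥ s) * ((u ⬝ᵥ u) * (w ⬝ᵥ w)) := by
  set p := u ⬝ᵥ u
  set q := w ⬝ᵥ w
  -- The component of `s` orthogonal to `u` and `w`, multiplied by `p q` to avoid division.
  set r : Fin 3 → ℝ := (p * q) • s - (q * (s ⬝ᵥ u)) • u - (p * (s ⬝ᵥ w)) • w with hr
  have h0 : 0 ≤ r ⬝ᵥ r := Finset.sum_nonneg fun i _ => mul_self_nonneg _
  have h1 : r ⬝ᵥ r = p * q * ((s ⬝ᵥ s) * (p * q) - ((s ⬝ᵥ u) ^ 2 * q + (s ⬝ᵥ w) ^ 2 * p)) := by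
    simp only [hr, sub_dotProduct, dotProduct_sub, smul_dotProduct, dotProduct_smul, smul_eq_mul,
      dotProduct_comm u s, dotProduct_comm w s, dotProduct_comm w u, huw]
    ring
  rw [h1] at h0
  have := nonneg_of_mul_nonneg_right h0 (mul_pos hu hw)
  linarith

/-- The expression is `α + β = a₀ · T u + a₁ · T w` with `u = b₀ + b₁` orthogonal to `w = b₀ - b₁`
and `|u|² + |w|² = 4`. Cauchy-Schwarz gives `α² ≤ k |u|² + (s · u)²`, likewise for `β`, and Bessel
gives `α²/|u|² + β²/|w|² ≤ 2k + (1 - k) = 1 + k`. Finally `(α + β)² ≤ (|u|² + |w|²) (α²/|u|² +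
β²/|w|²)`. -/
lemma chshValue_pauli_le (hψ : ∑ x, ‖ψ x‖ ^ 2 = 1) {a₀ a₁ b₀ b₁ : Fin 3 → ℝ}
    (ha₀ : a₀ ⬝ᵥ a₀ = 1) (ha₁ : a₁ ⬝ᵥ a₁ = 1) (hb₀ : b₀ ⬝ᵥ b₀ = 1) (hb₁ : b₁ ⬝ᵥ b₁ = 1) :
    chshValue ψ (pauli a₀) (pauli a₁) (pauli b₀) (pauli b₁) ≤ 2 * √(1 + concSq ψ) := by
  set u := b₀ + b₁ with hu
  set w := b₀ - b₁ with hw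
  set s := blochVec ψ
  set k := concSq ψ
  have hk : 0 ≤ k := concSq_nonneg ψ
  have hs : s ⬝ᵥ s = 1 - k := blochVec_dotProduct_self ψ hψ
  have hS : chshValue ψ (pauli a₀) (pauli a₁) (pauli b₀) (pauli b₁) =
      a₀ ⬝ᵥ corrVec ψ u + a₁ ⬝ᵥ corrVec ψ w := by
    rw [← corr_pauli, ← corr_pauli, hu, hw, pauli_add, pauli_sub, corr_add_right, corr_sub_right,
      chshValue]
    ring
  have huw : u ⬝ᵥ w = 0 := by
    simp only [hu, hw, add_dotProduct, dotProduct_sub, hb₀, hb₁, dotProduct_comm b₁ b₀]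
    ring
  have hpq : u ⬝ᵥ u + w ⬝ᵥ w = 4 := by
    simp only [hu, hw, add_dotProduct, sub_dotProduct, dotProduct_add, dotProduct_sub, hb₀, hb₁,
      dotProduct_comm b₁ b₀]
    ring
  have hα := sq_dotProduct_le a₀ (corrVec ψ u)
  have hβ := sq_dotProduct_le a₁ (corrVec ψ w)
  rw [ha₀, one_mul, corrVec_dotProduct_self] at hα
  rw [ha₁, one_mul, corrVec_dotProduct_self] at hβ
  have hx := sq_dotProduct_le s u
  have hy := sq_dotProduct_le s w
  have hbes := bessel_dotProduct s u w huw
  have hp0 : 0 ≤ u ⬝ᵥ u := Finset.sum_nonneg fun i _ => mul_self_nonneg _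
  have hq0 : 0 ≤ w ⬝ᵥ w := Finset.sum_nonneg fun i _ => mul_self_nonneg _
  rw [hS]
  change _ ≤ k * (u ⬝ᵥ u) + (s ⬝ᵥ u) ^ 2 at hα
  change _ ≤ k * (w ⬝ᵥ w) + (s ⬝ᵥ w) ^ 2 at hβ
  rw [hs] at hx hy hbes
  generalize (s ⬝ᵥ u) ^ 2 = x at *
  generalize (s ⬝ᵥ w) ^ 2 = y at *
  generalize u ⬝ᵥ u = p at *
  generalize w ⬝ᵥ w = q at *
  generalize a₀ ⬝ᵥ corrVec ψ u = α at *
  generalize a₁ ⬝ᵥ corrVec ψ w = β at *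
  suffices h : (α + β) ^ 2 ≤ 4 * (1 + k) by
    refine (Real.le_sqrt_of_sq_le h).trans_eq ?_
    rw [Real.sqrt_mul (by norm_num), show (4 : ℝ) = 2 ^ 2 by norm_num,
      Real.sqrt_sq (by norm_num)]
  -- If `u` or `w` vanishes one term drops out, and the other has square at most `4k + 4(1 - k) =
  -- 4`.
  rcases hp0.eq_or_lt with rfl | hp
  · have hα0 : α = 0 := by nlinarith
    rw [hα0]
    nlinarith
  rcases hq0.eq_or_lt with rfl | hq
  · have hβ0 : β = 0 := by nlinarith
    rw [hβ0]
    nlinarith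
  have hb := hbes hp hq
  have h1 : p * q * (α + β) ^ 2 ≤ (p + q) * (q * α ^ 2 + p * β ^ 2) := by
    nlinarith [sq_nonneg (q * α - p * β)]
  have h2 : q * α ^ 2 + p * β ^ 2 ≤ p * q * (1 + k) := by
    nlinarith [mul_le_mul_of_nonneg_left hα hq.le, mul_le_mul_of_nonneg_left hβ hp.le]
  rw [hpq] at h1
  have h3 : p * q * (α + β) ^ 2 ≤ p * q * (4 * (1 + k)) := by linarith
  exact le_of_mul_le_mul_left h3 (mul_pos hp hq)

/-- The expression is affine in each observable, so the four are replaced one after another by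
extreme points: `1` and `-1` give at most the classical value `2`, and four Pauli observables
remain. -/
lemma chshValue_le (hψ : ∑ x, ‖ψ x‖ ^ 2 = 1) {A₀ A₁ B₀ B₁ : Matrix (Fin 2) (Fin 2) ℂ}
    (hA₀ : IsObservable A₀) (hA₁ : IsObservable A₁) (hB₀ : IsObservable B₀)
    (hB₁ : IsObservable B₁) : chshValue ψ A₀ A₁ B₀ B₁ ≤ 2 * √(1 + concSq ψ) := by
  set b := 2 * √(1 + concSq ψ) with hb
  have h2 : 2 ≤ b := by
    have : 1 ≤ √(1 + concSq ψ) := Real.one_le_sqrt.mpr (by linarith [concSq_nonneg ψ])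
    linarith
  have c := fun {X Y Z} (hX : IsObservable X) (hY : IsObservable Y) (hZ : IsObservable Z) =>
    chshValue_le_two hψ hX hY hZ
  have eA₀ : ∀ X A₁ B₀ B₁, chshValue ψ X A₁ B₀ B₁ =
      (corr ψ X B₀ + corr ψ X B₁) + (corr ψ A₁ B₀ - corr ψ A₁ B₁) := fun _ _ _ _ => by
    rw [chshValue]; ring
  have eA₁ : ∀ A₀ X B₀ B₁, chshValue ψ A₀ X B₀ B₁ =
      (corr ψ X B₀ - corr ψ X B₁) + (corr ψ A₀ B₀ + corr ψ A₀ B₁) := fun _ _ _ _ => by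
    rw [chshValue]; ring
  have eB₀ : ∀ A₀ A₁ X B₁, chshValue ψ A₀ A₁ X B₁ =
      (corr ψ A₀ X + corr ψ A₁ X) + (corr ψ A₀ B₁ - corr ψ A₁ B₁) := fun _ _ _ _ => by
    rw [chshValue]; ring
  have eB₁ : ∀ A₀ A₁ B₀ X, chshValue ψ A₀ A₁ B₀ X =
      (corr ψ A₀ X - corr ψ A₁ X) + (corr ψ A₀ B₀ + corr ψ A₁ B₀) := fun _ _ _ _ => by
    rw [chshValue]; ring
  rw [eA₀]
  refine hA₀.le_of_extreme (f := fun X => corr ψ X B₀ + corr ψ X B₁)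
    (fun X Y => by simp only [corr_add_left]; ring) (fun r X => by simp only [corr_smul_left]; ring)
    ?_ ?_ fun a₀ ha₀ => ?_
  · rw [← eA₀]; exact (c hA₁ hB₀ hB₁).1.1.trans h2
  · rw [← eA₀]; exact (c hA₁ hB₀ hB₁).1.2.trans h2
  have hA₀ := isObservable_pauli ha₀
  rw [← eA₀, eA₁]
  refine hA₁.le_of_extreme (f := fun X => corr ψ X B₀ - corr ψ X B₁)
    (fun X Y => by simp only [corr_add_left]; ring) (fun r X => by simp only [corr_smul_left]; ring)
    ?_ ?_ fun a₁ ha₁ => ?_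
  · rw [← eA₁]; exact (c hA₀ hB₀ hB₁).2.1.1.trans h2
  · rw [← eA₁]; exact (c hA₀ hB₀ hB₁).2.1.2.trans h2
  have hA₁ := isObservable_pauli ha₁
  rw [← eA₁, eB₀]
  refine hB₀.le_of_extreme (f := fun X => corr ψ (pauli a₀) X + corr ψ (pauli a₁) X)
    (fun X Y => by simp only [corr_add_right]; ring)
    (fun r X => by simp only [corr_smul_right]; ring) ?_ ?_ fun b₀ hb₀ => ?_
  · rw [← eB₀]; exact (c hA₀ hA₁ hB₁).2.2.1.1.trans h2
  · rw [← eB₀]; exact (c hA₀ hA₁ hB₁).2.2.1.2.trans h2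
  have hB₀ := isObservable_pauli hb₀
  rw [← eB₀, eB₁]
  refine hB₁.le_of_extreme (f := fun X => corr ψ (pauli a₀) X - corr ψ (pauli a₁) X)
    (fun X Y => by simp only [corr_add_right]; ring)
    (fun r X => by simp only [corr_smul_right]; ring) ?_ ?_ fun b₁ hb₁ => ?_
  · rw [← eB₁]; exact (c hA₀ hA₁ hB₀).2.2.2.1.trans h2
  · rw [← eB₁]; exact (c hA₀ hA₁ hB₀).2.2.2.2.trans h2
  rw [← eB₁]
  exact chshValue_pauli_le hψ ha₀ ha₁ hb₀ hb₁

lemma exists_unit_orthogonal (n : Fin 3 → ℝ) : ∃ m : Fin 3 → ℝ, m ⬝ᵥ m = 1 ∧ n ⬝ᵥ m = 0 := by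
  by_cases h : n 0 = 0
  · exact ⟨![1, 0, 0], by simp [dotProduct, Fin.sum_univ_three],
      by simp [dotProduct, Fin.sum_univ_three, h]⟩
  · obtain ⟨m, hm, hw⟩ := exists_unit_dotProduct_eq ![-n 1, n 0, 0]
    set w : Fin 3 → ℝ := ![-n 1, n 0, 0] with hwd
    refine ⟨m, hm, ?_⟩
    have h1 : n ⬝ᵥ w = 0 := by
      simp [hwd, dotProduct, Fin.sum_univ_three]
      ring
    have h2 : 0 < w ⬝ᵥ w := by
      simp [hwd, dotProduct, Fin.sum_univ_three]
      have := mul_self_pos.mpr h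
      nlinarith [mul_self_nonneg (n 1)]
    rw [hw, dotProduct_smul, smul_eq_mul] at h1
    exact (mul_eq_zero.mp h1).resolve_left (Real.sqrt_pos.mpr h2).ne'

/-- With `n` along the Bloch vector and `m` orthogonal to it, `|T n| = 1` and `|T m| = √k`. Taking
`a₀`, `a₁` along these images and `b₀`, `b₁` equal to `C n ± D m` gives `2 (C + D √k)`, which is
largest for `C : D = 1 : √k`. -/
lemma exists_chshValue_eq (hψ : ∑ x, ‖ψ x‖ ^ 2 = 1) : ∃ a₀ a₁ b₀ b₁ : Fin 3 → ℝ,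
    a₀ ⬝ᵥ a₀ = 1 ∧ a₁ ⬝ᵥ a₁ = 1 ∧ b₀ ⬝ᵥ b₀ = 1 ∧ b₁ ⬝ᵥ b₁ = 1 ∧
    chshValue ψ (pauli a₀) (pauli a₁) (pauli b₀) (pauli b₁) = 2 * √(1 + concSq ψ) := by
  set s := blochVec ψ
  set k := concSq ψ
  have hk : 0 ≤ k := concSq_nonneg ψ
  have hs : s ⬝ᵥ s = 1 - k := blochVec_dotProduct_self ψ hψ
  have hs0 : 0 ≤ s ⬝ᵥ s := Finset.sum_nonneg fun i _ => mul_self_nonneg _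
  obtain ⟨n, hn, hsn⟩ := exists_unit_dotProduct_eq s
  obtain ⟨m, hm, hnm⟩ := exists_unit_orthogonal n
  have hsn' : (s ⬝ᵥ n) ^ 2 = 1 - k := by
    rw [hsn, smul_dotProduct, hn, smul_eq_mul, mul_one, Real.sq_sqrt hs0, hs]
  have hsm : s ⬝ᵥ m = 0 := by rw [hsn, smul_dotProduct, hnm, smul_zero]
  have hTn : corrVec ψ n ⬝ᵥ corrVec ψ n = 1 := by
    rw [corrVec_dotProduct_self, hn, hsn']
    change k * 1 + (1 - k) = 1
    ring
  have hTm : corrVec ψ m ⬝ᵥ corrVec ψ m = k := by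
    rw [corrVec_dotProduct_self, hm, hsm]
    change k * 1 + 0 ^ 2 = k
    ring
  obtain ⟨a₁, ha₁, hTa₁⟩ := exists_unit_dotProduct_eq (corrVec ψ m)
  have hc0 : 0 < √(1 + k) := Real.sqrt_pos.mpr (by linarith)
  have hcc : √(1 + k) * √(1 + k) = 1 + k := Real.mul_self_sqrt (by linarith)
  have hkk : √k * √k = k := Real.mul_self_sqrt hk
  set C := (√(1 + k))⁻¹ with hC
  set D := √k * (√(1 + k))⁻¹ with hD
  have hCD : C * C + D * D = 1 := by
    rw [hC, hD]
    field_simp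
    nlinarith
  have hT₁ : corr ψ (pauli a₁) (pauli m) = √k := by
    rw [corr_pauli, hTa₁, dotProduct_smul, ha₁, hTm, smul_eq_mul, mul_one]
  have hT₀ : corr ψ (pauli (corrVec ψ n)) (pauli n) = 1 := by rw [corr_pauli, hTn]
  refine ⟨corrVec ψ n, a₁, C • n + D • m, C • n - D • m, hTn, ha₁, ?_, ?_, ?_⟩
  · simp only [add_dotProduct, dotProduct_add, smul_dotProduct, dotProduct_smul, smul_eq_mul, hn,
      hm, hnm, dotProduct_comm m n]
    linear_combination hCD
  · simp only [sub_dotProduct, dotProduct_sub, smul_dotProduct, dotProduct_smul, smul_eq_mul, hn,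
      hm, hnm, dotProduct_comm m n]
    linear_combination hCD
  · simp only [chshValue, pauli_add, pauli_sub, pauli_smul, corr_add_right, corr_sub_right,
      corr_smul_right, hT₁, hT₀]
    have : 2 * C + 2 * D * √k = 2 * √(1 + k) := by
      rw [hC, hD]
      field_simp
      nlinarith
    linear_combination this

theorem isGreatest_chshWinProb (hψ : ∑ x, ‖ψ x‖ ^ 2 = 1) :
    IsGreatest {w : ℝ | ∃ A B : Measurement 2, w = chshWinProb (pureState ψ) A B}
      (omega (concurrence (pureState ψ))) := by
  rw [omega_concurrence_pureState]
  constructor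
  · obtain ⟨a₀, a₁, b₀, b₁, ha₀, ha₁, hb₀, hb₁, h⟩ := exists_chshValue_eq hψ
    refine ⟨Measurement.pauli (fun q => if q then a₁ else a₀) fun q => by split_ifs <;> assumption,
      Measurement.pauli (fun q => if q then b₁ else b₀) fun q => by split_ifs <;> assumption, ?_⟩
    rw [chshWinProb_eq hψ]
    simp only [Measurement.observable_pauli, Bool.false_eq_true, if_false, if_true, h]
    ring
  · rintro w ⟨A, B, rfl⟩
    rw [chshWinProb_eq hψ]
    have := chshValue_le hψ (A.isObservable false) (A.isObservable true) (B.isObservable false)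
      (B.isObservable true)
    linarith

/-! ### Discrimination of the levels -/

lemma strictMonoOn_omega : StrictMonoOn omega (Set.Ici 0) := by
  intro x hx y _ hxy
  have hx : (0 : ℝ) ≤ x := hx
  have : √(1 + x ^ 2) < √(1 + y ^ 2) := Real.sqrt_lt_sqrt (by positivity) (by nlinarith)
  unfold omega
  linarith

/-- At `c = 0` the inequality is strict, and both sides are continuous. -/
lemma eventually_one_add_mul_le {a b : ℝ} (h : a < b) :
    ∀ᶠ c : ℝ in nhds 0, (1 + c) * a ≤ (1 - c) * b := by
  have h1 : Filter.Tendsto (fun c : ℝ => (1 + c) * a) (nhds 0) (nhds ((1 + 0) * a)) :=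
    Continuous.tendsto (by fun_prop) 0
  have h2 : Filter.Tendsto (fun c : ℝ => (1 - c) * b) (nhds 0) (nhds ((1 - 0) * b)) :=
    Continuous.tendsto (by fun_prop) 0
  exact (h1.eventually_lt h2 (by simpa using h)).mono fun c hc => hc.le

lemma exists_forall_discriminates {ℓ : ℕ} {C : Fin ℓ → ℝ} (hC : StrictMono C)
    (hC0 : ∀ j, 0 ≤ C j) : ∃ c₀ : ℝ, 0 < c₀ ∧ ∀ c : ℝ, 0 < c → c ≤ c₀ → Discriminates C c := by
  have h : ∀ᶠ c : ℝ in nhds 0, (∀ i j, i < j → (1 + c) * omega (C i) ≤ (1 - c) * omega (C j)) ∧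
      ∀ j, 0 < C j → (1 + c) * omega 0 ≤ (1 - c) * omega (C j) := by
    simp only [Filter.eventually_and, Filter.eventually_all]
    exact ⟨fun i j hij => eventually_one_add_mul_le (strictMonoOn_omega (hC0 i) (hC0 j) (hC hij)),
      fun j hj => eventually_one_add_mul_le (strictMonoOn_omega (Set.mem_Ici.mpr le_rfl)
        (hC0 j) hj)⟩
  obtain ⟨ε, hε, hball⟩ := Metric.eventually_nhds_iff.mp h
  refine ⟨ε / 2, by positivity, fun c h0 hc => ?_⟩
  have := hball (y := c) (by rw [Real.dist_eq, sub_zero, abs_of_pos h0]; linarith)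
  exact ⟨h0, this.1, this.2⟩

lemma omega_zero : omega 0 = 3 / 4 := by
  norm_num [omega]

lemma three_quarters_le_omega (x : ℝ) : 3 / 4 ≤ omega x := by
  have : 1 ≤ √(1 + x ^ 2) := Real.one_le_sqrt.mpr (by nlinarith [sq_nonneg x])
  unfold omega
  linarith

/-- Here `y - p ≥ c p ≥ 3c/4`, so the exponent is at least `(9/8) c² N`, which exceeds the required
`(log 2 / 2) c² N`. -/
lemma exp_le_two_rpow {c p y : ℝ} (N : ℕ) (hc : 0 ≤ c) (hp : 3 / 4 ≤ p) (hpy : (1 + c) * p ≤ y) :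
    Real.exp (-2 * (y - p) ^ 2 * N) ≤ (2 : ℝ) ^ (-(c ^ 2 * N / 2)) := by
  rw [Real.rpow_def_of_pos (by norm_num)]
  apply Real.exp_le_exp.mpr
  have h1 : c * (3 / 4) ≤ y - p := by nlinarith
  have h2 : (c * (3 / 4)) ^ 2 ≤ (y - p) ^ 2 := pow_le_pow_left₀ (by positivity) h1 2
  have h3 : Real.log 2 ≤ 1 := by linarith [Real.log_two_lt_d9]
  have h4 : Real.log 2 * c ^ 2 ≤ 1 * c ^ 2 := mul_le_mul_of_nonneg_right h3 (sq_nonneg c)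
  have h5 : Real.log 2 * c ^ 2 / 2 ≤ 2 * (y - p) ^ 2 := by nlinarith [sq_nonneg c]
  nlinarith [mul_le_mul_of_nonneg_right h5 (Nat.cast_nonneg (α := ℝ) N)]

end QAuth

end

theorem theorem1 {ℓ : ℕ} (C : Fin ℓ → ℝ) (hC : StrictMono C) (hC01 : ∀ j, C j ∈ Set.Icc (0 : ℝ) 1)
    {U : Type*} [Fintype U] [DecidableEq U] (lvl : U → Fin ℓ) (N : ℕ) :
    -- `ω` is strictly increasing and is the optimal CHSH winning probability
    (StrictMonoOn QAuth.omega (Set.Icc 0 1) ∧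
      ∀ ψ : Fin 2 × Fin 2 → ℂ, ∑ x, ‖ψ x‖ ^ 2 = 1 →
        IsGreatest {w : ℝ | ∃ A B : QAuth.Measurement 2,
            w = QAuth.chshWinProb (QAuth.pureState ψ) A B}
          (QAuth.omega (QAuth.concurrence (QAuth.pureState ψ)))) ∧
    -- every sufficiently small tolerance discriminates the levels
    (∃ c₀ : ℝ, 0 < c₀ ∧ ∀ c : ℝ, 0 < c → c ≤ c₀ → QAuth.Discriminates C c) ∧
    -- no coalition passes for a higher level, or for an identity outside of it
    (∀ c : ℝ, QAuth.Discriminates C c →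
      ∀ ψ : U → Fin N → Fin 2 × Fin 2 → ℂ, (∀ u i, ∑ x, ‖ψ u i x‖ ^ 2 = 1) →
      (∀ u i, QAuth.concurrence (QAuth.pureState (ψ u i)) = C (lvl u)) →
      ∀ (A : Fin N → QAuth.Measurement 2) (S : Finset U) (σ : QAuth.Strategy S N 2) (v : U)
        (k' : Fin ℓ), (v ∈ S → lvl v < k') → (v ∉ S → 0 < C k') →
        QAuth.acceptProb c (C k')
            (σ.transcriptProb (fun u i => QAuth.pureState (ψ u i)) v A)
          ≤ (2 : ℝ) ^ (-(c ^ 2 * N / 2))) ∧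
    -- no coalition passes for a level whose winning probability it cannot achieve
    (∀ (c p : ℝ) (k' : Fin ℓ), 0 < c → p ≤ (1 - c) * QAuth.omega (C k') →
      ∀ (dA dB : ℕ) (ρ : U → Fin N → Matrix (Fin dA × Fin dB) (Fin dA × Fin dB) ℂ),
      (∀ u i, QAuth.IsDensity (ρ u i)) →
      ∀ (A : Fin N → QAuth.Measurement dA) (S : Finset U) (σ : QAuth.Strategy S N dB) (v : U),
        (∀ i, ∀ B : QAuth.Measurement dB, QAuth.chshWinProb (ρ v i) (A i) B ≤ p) →
        QAuth.acceptProb c (C k') (σ.transcriptProb ρ v A)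
          ≤ Real.exp (-2 * ((1 - c) * QAuth.omega (C k') - p) ^ 2 * N)) ∧
    -- nor do black boxes with memory
    (∀ (c p : ℝ) (k' : Fin ℓ), 0 < c → p ≤ (1 - c) * QAuth.omega (C k') →
      ∀ box : List QAuth.Round → QAuth.Experiment,
        (∀ h, QAuth.chshWinProb (box h).state (box h).alice (box h).bob ≤ p) →
        QAuth.acceptProb c (C k') (fun τ : Fin N → QAuth.Round =>
            QAuth.boxProb box [] (List.ofFn τ))
          ≤ Real.exp (-2 * ((1 - c) * QAuth.omega (C k') - p) ^ 2 * N)) := by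
  refine ⟨⟨QAuth.strictMonoOn_omega.mono Set.Icc_subset_Ici_self,
      fun ψ hψ => QAuth.isGreatest_chshWinProb hψ⟩,
    QAuth.exists_forall_discriminates hC fun j => (hC01 j).1, ?_, ?_, ?_⟩
  · intro c hc ψ hψ hconc A S σ v k' hin hout
    have hρ : ∀ u i, QAuth.IsDensity (QAuth.pureState (ψ u i)) := fun u i =>
      QAuth.isDensity_pureState (hψ u i)
    by_cases hv : v ∈ S
    -- The coalition wins a round with probability at most `ω` of the true level, and disjoint
    -- windows keep this a factor `1 + c` below the threshold.
    · have hlev := hc.levels _ _ (hin hv)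
      have hω := QAuth.three_quarters_le_omega (C (lvl v))
      refine (σ.acceptProb_transcriptProb_le hρ v A (p := QAuth.omega (C (lvl v))) hc.pos
        (hC01 k').1 (hC01 k').2 (by nlinarith [hc.pos]) (fun _ i B => ?_)
        (fun h => absurd hv h)).trans (QAuth.exp_le_two_rpow N hc.pos.le hω hlev)
      rw [← hconc v i]
      exact (QAuth.isGreatest_chshWinProb (hψ v i)).2 ⟨A i, B, rfl⟩
    -- Without the halves of `v` the bound is `3/4 = ω(0)`, which the second discrimination
    -- condition separates from every entangled level.
    · have hlev := hc.unentangled _ (hout hv)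
      rw [QAuth.omega_zero] at hlev
      exact (σ.acceptProb_transcriptProb_le hρ v A (p := 3 / 4) hc.pos
        (hC01 k').1 (hC01 k').2 (by linarith [hc.pos]) (fun h => absurd h hv)
        (fun _ i f => QAuth.chshWinProb_deterministic_le (hρ v i) (A i) f)).trans
        (QAuth.exp_le_two_rpow N hc.pos.le le_rfl hlev)
  · intro c p k' hc hpx dA dB ρ hρ A S σ v hp
    exact σ.acceptProb_transcriptProb_le hρ v A hc (hC01 k').1 (hC01 k').2 hpx (fun _ => hp)
      (fun _ i f => hp i _)
  · intro c p k' hc hpx box hp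
    exact QAuth.acceptProb_boxProb_le hc (hC01 k').1 (hC01 k').2 hpx box hp
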